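/- Let $I=[0,1]$ and let $\Theta$ be the Heaviside function, with $\Theta(0)=1$. Let $\mathcal A_\Theta(I)$ be the set of functions $f(t,s)=\tilde f(t,s)\Theta(t-s)$ on $I\times I$ with $\tilde f$ complex valued and analytic on a neighbourhood of $I\times I$, and let $\mathcal A_\Theta^t(I)\subset\mathcal A_\Theta(I)$ be the set of those of the form $f(t,s)=\tilde f(t)\Theta(t-s)$, with $\tilde f$ analytic on a neighbourhood of $I$. For distributions $d=\alpha\,\delta(t-s)+f(t,s)$ and $e=\beta\,\delta(t-s)+g(t,s)$ on $I\times I$ ($\alpha,\beta\in\mathbb C$ constants, $f,g$ functions) set $$d\star e=\alpha\beta\,\delta(t-s)+\alpha g+\beta f+f\star g,\qquad (f\star g)(t,s)=\int_0^1 f(t,\tau)g(\tau,s)\,d\tau ,$$ and $1_\star=\delta(t-s)$. Let $\mathcal D_0^t(I)$ be the set of all $$\alpha 1_\star+\sum_{i=1}^n g_{i,1}\star\cdots\star g_{i,m_i},\qquad \alpha\in\mathbb C,\ n\ge 0,\ m_i\ge1,\ g_{i,j}\in\mathcal A_\Theta^t(I).$$ Let $p_k(x)=\sqrt{2k+1}\,P_k(2x-1)$,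 $k\ge 0$, be the orthonormal shifted Legendre polynomials on $I$. The coefficient matrix of $d=\alpha\,\delta(t-s)+f(t,s)$ is the infinite matrix with entries $$F_{k,\ell}=\alpha\int_0^1 p_k(t)p_\ell(t)\,dt+\int_0^1\!\!\int_0^1 f(t,s)\,p_k(t)p_\ell(s)\,ds\,dt,\qquad k,\ell\ge 0.$$ The product of infinite matrices is $(FG)_{k,\ell}=\sum_{j\ge0}F_{k,j}G_{j,\ell}$; it is well defined if all these series converge absolutely. A matrix $F$ has geometric off-diagonal decay if there are $K>0$ and $0<\rho<1$ with $|F_{k,\ell}|\le K\rho^{|k-\ell|}$ for all $k,\ell$. Then the following hold. 1. If $f,g\in\mathcal A_\Theta^t(I)$ have the coefficient matrices $F,G$, then $f\star g\in\mathcal D_0^t(I)$, the matrices $F$ and $G$ have geometric off-diagonal decay, the product $FG$ is well defined, it is the coefficient matrix of $f\star g$, and it has geometric off-diagonal decay. 2. Every element of $\mathcal D_0^t(I)$ is of the form $\alpha 1_\star+f$ with $\alpha\in\mathbb C$ and $f\in\mathcal A_\Theta(I)$, and $(\mathcal D_0^t(I),\star,+,0,1_\star)$ is an associative unital ring (indeed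 a $\mathbb C$-algebra). Let $\mathcal F$ be the set of the coefficient matrices of the elements of $\mathcal D_0^t(I)$. Every $F\in\mathcal F$ has geometric off-diagonal decay, the product of any two elements of $\mathcal F$ is well defined, and $\mathcal F$, with the usual sum, scalar multiplication and matrix product, is an associative unital $\mathbb C$-algebra whose unit is the infinite identity matrix. The map that sends an element of $\mathcal D_0^t(I)$ to its coefficient matrix is an isomorphism of unital $\mathbb C$-algebras from $(\mathcal D_0^t(I),\star,+,0,1_\star)$ onto $\mathcal F$. 3. Let $N\in\mathbb N$. For $N\times N$ matrices $A=[A_{i,j}]$, $B=[B_{i,j}]$ with entries in $\mathcal D_0^t(I)$ put $(A\star B)_{i,j}=\sum_{m=1}^N A_{i,m}\star B_{m,j}$, and let $\mathbf A=[F^{(i,j)}]$, $\mathbf B=[G^{(i,j)}]$ be the block matrices of the coefficient matrices of the entries. Then all products $F^{(i,m)}G^{(m,j)}$ are well defined, the block matrix of $A\star B$ is $\mathbf A\mathbf B=\big[\sum_{m=1}^N F^{(i,m)}G^{(m,j)}\big]_{i,j}$, and each of its blocks has geometric off-diagonal decay. The $N\times N$ matrices over $\mathcal D_0^t(I)$ (with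 $\star$) and the $N\times N$ block matrices with blocks in $\mathcal F$ (with the block product) are associative unital $\mathbb C$-algebras, and $A\mapsto\mathbf A$ is an isomorphism of unital $\mathbb C$-algebras from the first onto the second. -/

import Mathlib

open MeasureTheory

noncomputable section

namespace LegendreStar

/-- The interval `[0,1]`, as a type carrying Lebesgue measure. -/
abbrev I : Type := unitInterval

/-- The Heaviside function, with the value `1` at `0`. -/
def heaviside (x : ℝ) : ℂ := if 0 ≤ x then 1 else 0

/-- The functions `f(t,s) = f̃(t,s) Θ(t-s)` on `[0,1]²` with `f̃` complex valued and (jointly)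
analytic over `[0,1]²`. -/
def ATheta : Set (I → I → ℂ) :=
  {f | ∃ f' : ℝ → ℝ → ℂ,
      AnalyticOnNhd ℝ (fun z : ℝ × ℝ => f' z.1 z.2) (Set.Icc 0 1 ×ˢ Set.Icc 0 1) ∧
      ∀ t s : I, f t s = f' t s * heaviside ((t : ℝ) - s)}

/-- The functions `f(t,s) = f̃(t) Θ(t-s)` on `[0,1]²` with `f̃` complex valued and analytic over
`[0,1]`. -/
def AThetaT : Set (I → I → ℂ) :=
  {f | ∃ f' : ℝ → ℂ, AnalyticOnNhd ℝ f' (Set.Icc 0 1) ∧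
      ∀ t s : I, f t s = f' t * heaviside ((t : ℝ) - s)}

/-- The star product of two functions, `(f ⋆ g)(t,s) = ∫_0^1 f(t,τ) g(τ,s) dτ`. -/
def starFun (f g : I → I → ℂ) : I → I → ℂ :=
  fun t s => ∫ τ : I, f t τ * g τ s

/-- The pair `(α, f)` stands for the distribution `α δ(t-s) + f(t,s)` on `[0,1]²`
(see `pairing` for its action on test functions). Sums and scalar multiples are those of pairs. -/
abbrev Dist0 : Type := ℂ × (I → I → ℂ)

/-- A function, seen as a distribution. -/
def ofFun (f : I → I → ℂ) : Dist0 := (0, f)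

/-- `1_⋆ = δ(t-s)`. -/
def starOne : Dist0 := (1, 0)

/-- The star product
`(α δ + f) ⋆ (β δ + g) = αβ δ + (α g + β f + f ⋆ g)`, that is `∫_0^1 d(t,τ) e(τ,s) dτ`. -/
def starMul (d e : Dist0) : Dist0 :=
  (d.1 * e.1, d.1 • e.2 + e.1 • d.2 + starFun d.2 e.2)

/-- The action of `α δ(t-s) + f(t,s)` on a test function `φ(t,s)`:
`α ∫ φ(t,t) dt + ∫∫ f(t,s) φ(t,s) ds dt`. -/
def pairing (d : Dist0) (φ : I → I → ℂ) : ℂ :=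
  d.1 * (∫ t : I, φ t t) + ∫ t : I, ∫ s : I, d.2 t s * φ t s

/-- The products `g₁ ⋆ ⋯ ⋆ g_m` with `m ≥ 1` and factors in `AThetaT`. -/
inductive IsStarMonomial : Dist0 → Prop
  | of (g : I → I → ℂ) (hg : g ∈ AThetaT) : IsStarMonomial (ofFun g)
  | mul (g : I → I → ℂ) (hg : g ∈ AThetaT) (d : Dist0) (hd : IsStarMonomial d) :
      IsStarMonomial (starMul (ofFun g) d)

/-- `D_0^t`: the distributions `α 1_⋆ + ∑_{i=1}^n g_{i,1} ⋆ ⋯ ⋆ g_{i,m_i}`. -/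
def D0t : Set Dist0 :=
  {d | ∃ (α : ℂ) (n : ℕ) (g : Fin n → Dist0),
      (∀ i, IsStarMonomial (g i)) ∧ d = α • starOne + ∑ i, g i}

/-- The orthonormal shifted Legendre polynomials `p_k(x) = √(2k+1) P_k(2x-1)` on `[0,1]`.
(The polynomial `Polynomial.shiftedLegendre k` is `P_k(1-2x) = (-1)^k P_k(2x-1)`.) -/
def legendreP (k : ℕ) (x : ℝ) : ℝ :=
  (-1) ^ k * Real.sqrt (2 * k + 1) * Polynomial.aeval x (Polynomial.shiftedLegendre k)

/-- Infinite matrices. -/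
abbrev InfMat : Type := Matrix ℕ ℕ ℂ

/-- The coefficient matrix: its entry `(k,ℓ)` is the action of `d` on `p_k(t) p_ℓ(s)`; for a
function `f` this is `∫∫ f(t,s) p_k(t) p_ℓ(s) ds dt`. -/
def coeffMatrix (d : Dist0) : InfMat :=
  fun k l => pairing d (fun t s => (legendreP k t : ℂ) * (legendreP l s : ℂ))

/-- All the series that define the entries of the product of two infinite matrices converge
(in `ℂ`, `Summable` means absolute convergence). -/
def MulDefined (F G : InfMat) : Prop :=
  ∀ k l, Summable fun j => F k j * G j l

/-- The product of infinite matrices. -/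
def infMul (F G : InfMat) : InfMat :=
  fun k l => ∑' j, F k j * G j l

/-- Geometric decay of the entries away from the diagonal. -/
def HasGeometricDecay (F : InfMat) : Prop :=
  ∃ K ρ : ℝ, 0 < K ∧ 0 < ρ ∧ ρ < 1 ∧
    ∀ k l : ℕ, ‖F k l‖ ≤ K * ρ ^ ((k : ℤ) - (l : ℤ)).natAbs

/-- The set of all the coefficient matrices of elements of `D0t`. -/
def coeffMatrices : Set InfMat := coeffMatrix '' D0t

/-- `S` is a complex linear subspace which, with the product `mul` and the unit `one`, is an
associative unital complex algebra (in particular a ring). -/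
structure IsUnitalAlgebraOn {A : Type*} [AddCommGroup A] [Module ℂ A]
    (S : Set A) (mul : A → A → A) (one : A) : Prop where
  zero_mem : (0 : A) ∈ S
  one_mem : one ∈ S
  add_mem : ∀ a ∈ S, ∀ b ∈ S, a + b ∈ S
  neg_mem : ∀ a ∈ S, -a ∈ S
  smul_mem : ∀ (c : ℂ), ∀ a ∈ S, c • a ∈ S
  mul_mem : ∀ a ∈ S, ∀ b ∈ S, mul a b ∈ S
  mul_assoc : ∀ a ∈ S, ∀ b ∈ S, ∀ c ∈ S, mul (mul a b) c = mul a (mul b c)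
  one_mul : ∀ a ∈ S, mul one a = a
  mul_one : ∀ a ∈ S, mul a one = a
  mul_add : ∀ a ∈ S, ∀ b ∈ S, ∀ c ∈ S, mul a (b + c) = mul a b + mul a c
  add_mul : ∀ a ∈ S, ∀ b ∈ S, ∀ c ∈ S, mul (a + b) c = mul a c + mul b c
  smul_mul : ∀ (r : ℂ), ∀ a ∈ S, ∀ b ∈ S, mul (r • a) b = r • mul a b
  mul_smul : ∀ (r : ℂ), ∀ a ∈ S, ∀ b ∈ S, mul a (r • b) = r • mul a b

/-- `φ` restricts to an isomorphism of unital complex algebras from `(S, mulA, oneA)` onto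
`(T, mulB, oneB)`. -/
structure IsAlgebraIsoOn {A B : Type*} [AddCommGroup A] [Module ℂ A] [AddCommGroup B] [Module ℂ B]
    (S : Set A) (mulA : A → A → A) (oneA : A) (T : Set B) (mulB : B → B → B) (oneB : B)
    (φ : A → B) : Prop where
  bijOn : Set.BijOn φ S T
  map_add : ∀ a ∈ S, ∀ b ∈ S, φ (a + b) = φ a + φ b
  map_smul : ∀ (c : ℂ), ∀ a ∈ S, φ (c • a) = c • φ a
  map_mul : ∀ a ∈ S, ∀ b ∈ S, φ (mulA a b) = mulB (φ a) (φ b)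
  map_one : φ oneA = oneB

/-- `N × N` matrices of distributions. -/
abbrev MatDist0 (N : ℕ) : Type := Matrix (Fin N) (Fin N) Dist0

/-- `N × N` block matrices whose blocks are infinite matrices. -/
abbrev BlockMat (N : ℕ) : Type := Matrix (Fin N) (Fin N) InfMat

/-- The star product of matrices, `(A ⋆ B)_{ij} = ∑_m A_{im} ⋆ B_{mj}`. -/
def matStarMul {N : ℕ} (A B : MatDist0 N) : MatDist0 N :=
  fun i j => ∑ m, starMul (A i m) (B m j)

/-- The identity matrix `I_⋆`, with `1_⋆` on the diagonal. -/
def matStarOne (N : ℕ) : MatDist0 N :=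
  fun i j => if i = j then starOne else 0

/-- The block matrix of the coefficient matrices of the entries. -/
def blockCoeff {N : ℕ} (A : MatDist0 N) : BlockMat N :=
  fun i j => coeffMatrix (A i j)

/-- The product of block matrices, `(𝐀𝐁)_{ij} = ∑_m 𝐀_{im} 𝐁_{mj}`. -/
def blockMul {N : ℕ} (A B : BlockMat N) : BlockMat N :=
  fun i j => ∑ m, infMul (A i m) (B m j)

/-- The identity block matrix. -/
def blockOne (N : ℕ) : BlockMat N :=
  fun i j => if i = j then 1 else 0

/-- The `N × N` matrices with entries in `D0t`. -/
def matD0t (N : ℕ) : Set (MatDist0 N) := {A | ∀ i j, A i j ∈ D0t}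

/-- The `N × N` block matrices with blocks in `coeffMatrices`. -/
def blockCoeffMatrices (N : ℕ) : Set (BlockMat N) := {M | ∀ i j, M i j ∈ coeffMatrices}

end LegendreStar

end

noncomputable section

namespace LegendreStar

section

open Polynomial

/-! ### Integration of polynomials over the unit interval -/

/-! A distribution `α δ + f` with bounded kernel acts on functions by `v ↦ α v + ∫ f(·,s) v(s) ds`;
the star product is composition of these operators (`distApply_starMul`), and the coefficient matrix
is the matrix of the operator in the Legendre basis. Multiplicativity is therefore Parseval's
identity for the pairing of the transposed action of `d` on `p_k` with the action of `e` on `p_ℓ`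
(`hasSum_coeffMatrix_mul`). Parseval also gives the absolute convergence, so no decay is needed for
the product to be defined.

Decay of a product is not obtained by multiplying two decaying matrices. The kernels that occur in
`D0t` all lie in the span of the separable kernels `a(t) b(s) Θ(t-s)` with `a`, `b` analytic. This
span is stable under the star product, because the inner integral is `P(t) - P(s)` for an analytic
antiderivative `P` (`starFun_mem_span`). It thus suffices to treat one separable kernel. If `a`, `b`
are polynomials of degree at most `n`, orthogonality makes the matrix banded, with width `2n+1`
(`coeffMatrix_eq_zero_of_polynomial`). In general `a` and `b` are approximated by such polynomials
with uniform error `O(r^n)` (`exists_polynomial_approx`); a uniform kernel error bounds every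
coefficient, and taking `n` about half of `|k-ℓ|` gives the decay
(`hasGeometricDecay_of_mem_sepKernels`).

The approximation is the truncated Chebyshev series: `θ ↦ f((1 + cos 2πθ)/2)` is periodic, even and
analytic, and its Fourier coefficients decay geometrically by repeated integration by parts against
the bounds `C M^n n!` on its derivatives.

Injectivity (`eq_zero_of_coeffMatrix_eq_zero`) uses completeness of the Legendre polynomials. A zero
matrix means a zero operator; the integral part applied to `1` is `O(t)` near `t = 0`, which forces
`α = 0`, and then continuity of `f̃` forces `f = 0`. The remaining algebra laws, also for matrices,
are transported along the bijection. -/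

theorem integral_unitInterval (f : ℝ → ℂ) : ∫ t : I, f t = ∫ t in (0 : ℝ)..1, f t := by
  rw [intervalIntegral.integral_of_le zero_le_one, ← integral_Icc_eq_integral_Ioc]
  exact integral_subtype_comap measurableSet_Icc f

theorem integrable_of_continuous {E : Type*} [NormedAddCommGroup E] {f : I → E}
    (hf : Continuous f) : Integrable f :=
  hf.integrable_of_hasCompactSupport (HasCompactSupport.of_compactSpace f)

theorem continuous_eval (p : ℂ[X]) : Continuous fun t : I => p.eval ((t : ℝ) : ℂ) :=
  p.continuous.comp (Complex.continuous_ofReal.comp continuous_subtype_val)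

/-- The integral of a complex polynomial over `[0,1]`. -/
def polyInt : ℂ[X] →ₗ[ℂ] ℂ where
  toFun p := ∫ t : I, p.eval ((t : ℝ) : ℂ)
  map_add' p q := by
    simp only [eval_add]
    exact integral_add (integrable_of_continuous (continuous_eval p))
      (integrable_of_continuous (continuous_eval q))
  map_smul' c p := by
    simp only [eval_smul, RingHom.id_apply]
    exact integral_smul c _

theorem polyInt_apply (p : ℂ[X]) : polyInt p = ∫ t : I, p.eval ((t : ℝ) : ℂ) := rfl

theorem polyInt_derivative (p : ℂ[X]) : polyInt (derivative p) = p.eval 1 - p.eval 0 := by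
  have h : ∀ x ∈ Set.uIcc (0 : ℝ) 1,
      HasDerivAt (fun t : ℝ => p.eval (t : ℂ)) ((derivative p).eval (x : ℂ)) x :=
    fun x _ => (p.hasDerivAt (x : ℂ)).comp_ofReal
  have hc : Continuous fun t : ℝ => (derivative p).eval (t : ℂ) :=
    (derivative p).continuous.comp Complex.continuous_ofReal
  rw [polyInt_apply, integral_unitInterval fun t : ℝ => (derivative p).eval (t : ℂ),
    intervalIntegral.integral_eq_sub_of_hasDerivAt h (hc.intervalIntegrable _ _)]
  simp

theorem polyInt_derivative_mul {p q : ℂ[X]} (h0 : p.eval 0 = 0) (h1 : p.eval 1 = 0) :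
    polyInt (derivative p * q) = -polyInt (p * derivative q) := by
  have h := polyInt_derivative (p * q)
  rw [derivative_mul, map_add, eval_mul, eval_mul, h0, h1] at h
  linear_combination h

theorem polyInt_iterate_derivative_mul (w : ℂ[X]) (k : ℕ)
    (h : ∀ j < k, (derivative^[j] w).eval 0 = 0 ∧ (derivative^[j] w).eval 1 = 0) (q : ℂ[X]) :
    polyInt (derivative^[k] w * q) = (-1) ^ k * polyInt (w * derivative^[k] q) := by
  induction k generalizing q with
  | zero => simp
  | succ k ih =>
    have hk := h k (Nat.lt_succ_self k)
    rw [Function.iterate_succ_apply', polyInt_derivative_mul hk.1 hk.2,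
      ih (fun j hj => h j (hj.trans (Nat.lt_succ_self k))), ← Function.iterate_succ_apply]
    ring

/-- The Beta integral, by induction on `b`: the integral of the derivative of `X^(a+1) (1-X)^(b+1)`
is zero and relates `(a, b+1)` to `(a+1, b)`. It supplies the norm of the Legendre polynomials. -/
theorem polyInt_beta (a b : ℕ) :
    polyInt (X ^ a * (1 - X) ^ b) * (a + b + 1).factorial = a.factorial * b.factorial := by
  induction b generalizing a with
  | zero =>
    have h := polyInt_derivative (X ^ (a + 1))
    rw [derivative_X_pow] at h
    simp only [add_tsub_cancel_right, eval_pow, eval_X, one_pow, ne_eq, Nat.add_eq_zero_iff,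
      one_ne_zero, and_false, not_false_eq_true, zero_pow, sub_zero, ← smul_eq_C_mul,
      map_smul, smul_eq_mul] at h
    simp only [pow_zero, mul_one, add_zero, Nat.factorial_succ, Nat.factorial_zero]
    push_cast at h ⊢
    linear_combination (a.factorial : ℂ) * h
  | succ b ih =>
    have h := polyInt_derivative (X ^ (a + 1) * (1 - X) ^ (b + 1))
    have e : derivative (X ^ (a + 1) * (1 - X) ^ (b + 1) : ℂ[X]) =
        ((a : ℂ) + 1) • (X ^ a * (1 - X) ^ (b + 1)) -
          ((b : ℂ) + 1) • (X ^ (a + 1) * (1 - X) ^ b) := by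
      simp only [derivative_mul, derivative_pow, derivative_sub, derivative_one,
        derivative_X, smul_eq_C_mul, map_add, map_one]
      push_cast
      simp
      ring
    rw [e, map_sub, map_smul, map_smul] at h
    simp only [smul_eq_mul, eval_mul, eval_pow, eval_X, eval_sub, eval_one, sub_self, ne_eq,
      Nat.add_eq_zero_iff, one_ne_zero, and_false, not_false_eq_true, zero_pow, mul_zero,
      zero_mul] at h
    have hb := ih (a + 1)
    rw [show a + 1 + b + 1 = a + (b + 1) + 1 by ring] at hb
    have ha : (a : ℂ) + 1 ≠ 0 := Nat.cast_add_one_ne_zero a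
    apply mul_left_cancel₀ ha
    rw [Nat.factorial_succ a] at hb
    rw [Nat.factorial_succ b]
    push_cast at hb ⊢
    linear_combination ((a + (b + 1) + 1).factorial : ℂ) * h + ((b : ℂ) + 1) * hb

/-! ### Orthonormality of the shifted Legendre polynomials -/

/-- The shifted Legendre polynomials of Mathlib, with complex coefficients. -/
def shiftedC (k : ℕ) : ℂ[X] := (shiftedLegendre k).map (Int.castRingHom ℂ)

/-- Rodrigues' formula, the source of both orthogonality and normalisation. -/
theorem factorial_smul_shiftedC (k : ℕ) :
    (k.factorial : ℂ) • shiftedC k = derivative^[k] (X ^ k * (1 - X) ^ k) := by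
  have h := congrArg (Polynomial.map (Int.castRingHom ℂ)) (factorial_mul_shiftedLegendre_eq k)
  rw [Polynomial.map_mul, ← iterate_derivative_map] at h
  simpa [shiftedC, smul_eq_C_mul] using h

theorem natDegree_shiftedC (k : ℕ) : (shiftedC k).natDegree = k := by
  rw [shiftedC, natDegree_map_eq_of_injective (RingHom.injective_int _), natDegree_shiftedLegendre]

theorem coeff_shiftedC (k : ℕ) : (shiftedC k).coeff k = (-1) ^ k * ((2 * k).choose k : ℂ) := by
  simp [shiftedC, coeff_shiftedLegendre, two_mul]

/-- Fewer than `k` derivatives leave a factor `X` and a factor `1 - X`; these are the vanishing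
boundary terms in the `k`-fold integration by parts. -/
theorem eval_iterate_derivative_weight (k j : ℕ) (h : j < k) :
    (derivative^[j] (X ^ k * (1 - X) ^ k : ℂ[X])).eval 0 = 0 ∧
      (derivative^[j] (X ^ k * (1 - X) ^ k : ℂ[X])).eval 1 = 0 := by
  have hk : k - j ≠ 0 := by omega
  constructor
  · obtain ⟨r, hr⟩ := pow_sub_dvd_iterate_derivative_of_pow_dvd (p := (X ^ k * (1 - X) ^ k : ℂ[X]))
      (q := X) (n := k) j (dvd_mul_right _ _)
    rw [hr]; simp [hk]
  · obtain ⟨r, hr⟩ := pow_sub_dvd_iterate_derivative_of_pow_dvd (p := (X ^ k * (1 - X) ^ k : ℂ[X]))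
      (q := 1 - X) (n := k) j (dvd_mul_left _ _)
    rw [hr]; simp [hk]

theorem polyInt_shiftedC_mul (k : ℕ) (q : ℂ[X]) :
    (k.factorial : ℂ) * polyInt (shiftedC k * q) =
      (-1) ^ k * polyInt (X ^ k * (1 - X) ^ k * derivative^[k] q) := by
  rw [← polyInt_iterate_derivative_mul _ k (eval_iterate_derivative_weight k),
    ← factorial_smul_shiftedC, smul_mul_assoc, map_smul, smul_eq_mul]

theorem polyInt_shiftedC_mul_of_degree_lt {k : ℕ} {q : ℂ[X]} (h : q.natDegree < k) :
    polyInt (shiftedC k * q) = 0 := by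
  have := polyInt_shiftedC_mul k q
  rw [iterate_derivative_eq_zero h, mul_zero, map_zero, mul_zero] at this
  exact (mul_eq_zero.mp this).resolve_left (Nat.cast_ne_zero.mpr k.factorial_ne_zero)

/-- After moving `k` derivatives, the second factor is the constant `k!` times the leading
coefficient `(-1)^k (2k choose k)`, and what is left is the Beta integral `k!²/(2k+1)!`. -/
theorem polyInt_shiftedC_sq (k : ℕ) :
    polyInt (shiftedC k * shiftedC k) * (2 * k + 1) = 1 := by
  have h := polyInt_shiftedC_mul k (shiftedC k)
  have hd : derivative^[k] (shiftedC k) =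
      C ((k.factorial : ℂ) * ((-1) ^ k * ((2 * k).choose k : ℂ))) := by
    have h0 : (derivative^[k] (shiftedC k)).natDegree = 0 := by
      have := natDegree_iterate_derivative (shiftedC k) k
      rw [natDegree_shiftedC] at this; omega
    rw [eq_C_of_natDegree_eq_zero h0, coeff_iterate_derivative]
    simp [coeff_shiftedC, Nat.descFactorial_self]
  have hb := polyInt_beta k k
  have hc : ((2 * k).choose k : ℂ) * k.factorial * k.factorial = (2 * k).factorial := by
    have := Nat.choose_mul_factorial_mul_factorial (n := 2 * k) (k := k) (by omega)
    rw [show 2 * k - k = k by omega] at this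
    exact_mod_cast this
  rw [hd, mul_comm _ (C _), ← smul_eq_C_mul, map_smul, smul_eq_mul] at h
  have hk : (k.factorial : ℂ) ≠ 0 := Nat.cast_ne_zero.mpr k.factorial_ne_zero
  have h2 : ((2 * k).factorial : ℂ) ≠ 0 := Nat.cast_ne_zero.mpr (2 * k).factorial_ne_zero
  have hs : ((-1 : ℂ) ^ k) * (-1) ^ k = 1 := by rw [← mul_pow]; simp
  rw [← two_mul, Nat.factorial_succ] at hb
  push_cast at hb
  set W := polyInt (X ^ k * (1 - X) ^ k)
  set S := polyInt (shiftedC k * shiftedC k)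
  have h' : S = ((2 * k).choose k : ℂ) * W := by
    apply mul_left_cancel₀ hk
    rw [h]
    linear_combination (k.factorial : ℂ) * ((2 * k).choose k : ℂ) * W * hs
  apply mul_left_cancel₀ h2
  rw [h']
  linear_combination ((2 * k).choose k : ℂ) * hb + hc

/-- The orthonormal shifted Legendre polynomials, as complex polynomials. -/
def legC (k : ℕ) : ℂ[X] := (((-1) ^ k * Real.sqrt (2 * k + 1) : ℝ) : ℂ) • shiftedC k

theorem eval_legC (k : ℕ) (x : ℝ) : (legC k).eval (x : ℂ) = (legendreP k x : ℂ) := by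
  have h : (shiftedC k).eval (x : ℂ) = ((aeval x (shiftedLegendre k) : ℝ) : ℂ) := by
    rw [shiftedC, eval_map, ← algebraMap_int_eq]
    exact aeval_algebraMap_apply ℂ x (shiftedLegendre k)
  rw [legC, eval_smul, h, legendreP, smul_eq_mul]
  push_cast
  ring

theorem natDegree_legC_le (k : ℕ) : (legC k).natDegree ≤ k :=
  (natDegree_smul_le _ _).trans (natDegree_shiftedC k).le

theorem polyInt_legC_mul_of_degree_lt {k : ℕ} {q : ℂ[X]} (h : q.natDegree < k) :
    polyInt (legC k * q) = 0 := by
  rw [legC, smul_mul_assoc, map_smul, polyInt_shiftedC_mul_of_degree_lt h, smul_zero]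

theorem polyInt_legC_mul_legC (k l : ℕ) : polyInt (legC k * legC l) = if k = l then 1 else 0 := by
  rcases lt_trichotomy k l with h | rfl | h
  · rw [mul_comm, polyInt_legC_mul_of_degree_lt ((natDegree_legC_le k).trans_lt h), if_neg h.ne]
  · rw [legC, smul_mul_smul_comm, map_smul, smul_eq_mul, ← Complex.ofReal_mul, if_pos rfl]
    rw [show (-1 : ℝ) ^ k * Real.sqrt (2 * k + 1) * ((-1) ^ k * Real.sqrt (2 * k + 1)) =
        2 * k + 1 by
      rw [mul_mul_mul_comm, ← mul_pow, Real.mul_self_sqrt (by positivity)]; simp]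
    push_cast
    rw [mul_comm, polyInt_shiftedC_sq]
  · rw [polyInt_legC_mul_of_degree_lt ((natDegree_legC_le l).trans_lt h), if_neg h.ne']

theorem continuous_legendreP (k : ℕ) : Continuous fun t : I => (legendreP k t : ℂ) := by
  simp_rw [← eval_legC]; exact continuous_eval _

theorem integral_legendreP_mul_legendreP (k l : ℕ) :
    ∫ t : I, (legendreP k t : ℂ) * legendreP l t = if k = l then 1 else 0 := by
  rw [← polyInt_legC_mul_legC, polyInt_apply]
  simp [eval_mul, eval_legC]

theorem integral_eval_mul_legendreP {k : ℕ} {q : ℂ[X]} (h : q.natDegree < k) :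
    ∫ t : I, q.eval ((t : ℝ) : ℂ) * legendreP k t = 0 := by
  rw [← polyInt_legC_mul_of_degree_lt h, polyInt_apply]
  simp [eval_mul, eval_legC, mul_comm]

end

section

open Polynomial

/-! ### Completeness of the shifted Legendre polynomials -/

theorem span_legC : Submodule.span ℂ (Set.range legC) = ⊤ := by
  have hd (k : ℕ) : (shiftedC k).degree = k := by
    rw [shiftedC, degree_map_eq_of_injective (RingHom.injective_int _), degree_shiftedLegendre]
  have hc (k : ℕ) : (((-1) ^ k * Real.sqrt (2 * k + 1) : ℝ) : ℂ) ≠ 0 := by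
    rw [Complex.ofReal_ne_zero]
    exact mul_ne_zero (pow_ne_zero _ (by norm_num)) (Real.sqrt_ne_zero'.mpr (by positivity))
  let S : Polynomial.Sequence ℂ :=
    ⟨legC, fun k => by rw [legC, smul_eq_C_mul, degree_C_mul (hc k), hd]⟩
  exact S.span fun i => (leadingCoeff_ne_zero.mpr (S.ne_zero i)).isUnit

/-- A complex polynomial as a continuous function on `[0,1]`. -/
def polyCM : ℂ[X] →ₗ[ℂ] C(I, ℂ) where
  toFun p := ⟨fun t => p.eval ((t : ℝ) : ℂ), continuous_eval p⟩
  map_add' p q := by ext; simp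
  map_smul' c p := by ext; simp

theorem bernsteinApproximation_mem_range (f : C(I, ℂ)) (n : ℕ) :
    bernsteinApproximation n f ∈ LinearMap.range polyCM := by
  refine ⟨∑ k : Fin (n + 1), (f (bernstein.z k)) •
    ((bernsteinPolynomial ℝ n k).map (algebraMap ℝ ℂ)), ?_⟩
  ext t
  simp only [polyCM, LinearMap.coe_mk, AddHom.coe_mk, ContinuousMap.coe_mk, eval_finsetSum,
    eval_smul, bernsteinApproximation.apply, smul_eq_mul]
  refine Finset.sum_congr rfl fun k _ => ?_
  have : (map (algebraMap ℝ ℂ) (bernsteinPolynomial ℝ n k)).eval ((t : ℝ) : ℂ) =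
      ((bernstein n k t : ℝ) : ℂ) := by
    rw [eval_map_algebraMap]
    exact aeval_algebraMap_apply ℂ (t : ℝ) _
  rw [this, Complex.real_smul, mul_comm]

/-- Weierstrass' theorem, through Bernstein polynomials with complex weights. -/
theorem range_polyCM_closure : (LinearMap.range polyCM).topologicalClosure = ⊤ := by
  rw [eq_top_iff]
  intro f _
  exact mem_closure_of_tendsto (bernsteinApproximation_uniform f)
    (Filter.Eventually.of_forall fun n => bernsteinApproximation_mem_range f n)

/-- The shifted Legendre polynomials in `L²[0,1]`. -/
def legLp (k : ℕ) : Lp ℂ 2 (volume : Measure I) :=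
  ContinuousMap.toLp (E := ℂ) 2 volume ℂ (polyCM (legC k))

theorem coeFn_legLp (k : ℕ) : legLp k =ᵐ[volume] fun t : I => (legendreP k t : ℂ) := by
  filter_upwards [ContinuousMap.coeFn_toLp (𝕜 := ℂ) (p := 2) volume (polyCM (legC k))] with t ht
  rw [legLp, ht]
  exact eval_legC k t

theorem orthonormal_legLp : Orthonormal ℂ legLp := by
  rw [orthonormal_iff_ite]
  intro i j
  rw [L2.inner_def, ← integral_legendreP_mul_legendreP]
  refine integral_congr_ae ?_
  filter_upwards [coeFn_legLp i, coeFn_legLp j] with t hi hj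
  rw [hi, hj, RCLike.inner_apply, Complex.conj_ofReal, mul_comm]

theorem span_legLp_closure :
    (Submodule.span ℂ (Set.range legLp)).topologicalClosure = ⊤ := by
  convert! (ContinuousMap.toLp_denseRange ℂ (volume : Measure I) ℂ
    ENNReal.ofNat_ne_top).topologicalClosure_map_submodule range_polyCM_closure
  rw [← Submodule.map_top polyCM, ← span_legC, Submodule.map_span, Submodule.map_span,
    ← Set.range_comp, ← Set.range_comp]
  rfl

/-- The shifted Legendre polynomials as a Hilbert basis of `L²[0,1]`. -/
def legBasis : HilbertBasis ℕ ℂ (Lp ℂ 2 (volume : Measure I)) :=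
  HilbertBasis.mk orthonormal_legLp span_legLp_closure.ge

/-- Parseval in bilinear form. The inner product is conjugate linear in the first slot, so it is
applied to the conjugate of `u`; the `p_j` are real and need no conjugation. -/
theorem hasSum_legendre {u v : I → ℂ} (hu : MemLp u 2) (hv : MemLp v 2) :
    HasSum (fun j => (∫ t : I, u t * legendreP j t) * ∫ t : I, (legendreP j t : ℂ) * v t)
      (∫ t : I, u t * v t) := by
  have hu' : MemLp (fun t => (starRingEnd ℂ) (u t)) 2 (volume : Measure I) := hu.star
  have h := legBasis.hasSum_inner_mul_inner (hu'.toLp _) (hv.toLp _)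
  simp only [legBasis, HilbertBasis.coe_mk, L2.inner_def] at h
  convert! h using 1
  · ext j
    congr 1
    · refine integral_congr_ae ?_
      filter_upwards [coeFn_legLp j, hu'.coeFn_toLp] with t hj ht
      rw [hj, ht, RCLike.inner_apply, Complex.conj_conj, mul_comm]
    · refine integral_congr_ae ?_
      filter_upwards [coeFn_legLp j, hv.coeFn_toLp] with t hj ht
      rw [hj, ht, RCLike.inner_apply, Complex.conj_ofReal, mul_comm]
  · refine integral_congr_ae ?_
    filter_upwards [hu'.coeFn_toLp, hv.coeFn_toLp] with t hu ht
    rw [hu, ht, RCLike.inner_apply, Complex.conj_conj, mul_comm]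

theorem ae_eq_zero_of_forall_integral_legendreP {v : I → ℂ} (hv : MemLp v 2)
    (h : ∀ j, ∫ t : I, (legendreP j t : ℂ) * v t = 0) : v =ᵐ[volume] 0 := by
  have h0 : legBasis.repr (hv.toLp v) = 0 := by
    ext j
    rw [HilbertBasis.repr_apply_apply, legBasis, HilbertBasis.coe_mk, L2.inner_def, lp.coeFn_zero,
      Pi.zero_apply, ← h j]
    refine integral_congr_ae ?_
    filter_upwards [coeFn_legLp j, hv.coeFn_toLp] with t hj ht
    rw [hj, ht, RCLike.inner_apply, Complex.conj_ofReal, mul_comm]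
  rw [LinearIsometryEquiv.map_eq_zero_iff] at h0
  filter_upwards [hv.coeFn_toLp, Lp.coeFn_zero ℂ 2 (volume : Measure I)] with t h1 h2
  rw [← h1, h0, h2]

end

section

/-! ### Bounded measurable functions -/

/-- Bounded measurable functions. -/
def BddMeas {α : Type*} [MeasurableSpace α] (f : α → ℂ) : Prop :=
  Measurable f ∧ ∃ C : ℝ, ∀ x, ‖f x‖ ≤ C

namespace BddMeas

variable {α β : Type*} [MeasurableSpace α] [MeasurableSpace β] {f g : α → ℂ}

theorem const (c : ℂ) : BddMeas fun _ : α => c := ⟨measurable_const, ‖c‖, fun _ => le_rfl⟩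

theorem add (hf : BddMeas f) (hg : BddMeas g) : BddMeas fun x => f x + g x := by
  obtain ⟨hf, C, hC⟩ := hf
  obtain ⟨hg, D, hD⟩ := hg
  exact ⟨hf.add hg, C + D, fun x => norm_add_le_of_le (hC x) (hD x)⟩

theorem mul (hf : BddMeas f) (hg : BddMeas g) : BddMeas fun x => f x * g x := by
  obtain ⟨hf, C, hC⟩ := hf
  obtain ⟨hg, D, hD⟩ := hg
  refine ⟨hf.mul hg, C * D, fun x => ?_⟩
  rw [norm_mul]
  exact mul_le_mul (hC x) (hD x) (norm_nonneg _) ((norm_nonneg _).trans (hC x))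

theorem comp (hf : BddMeas f) {φ : β → α} (hφ : Measurable φ) : BddMeas fun x => f (φ x) :=
  ⟨hf.1.comp hφ, hf.2.imp fun _ hC x => hC (φ x)⟩

theorem integrable (hf : BddMeas f) (μ : Measure α) [IsFiniteMeasure μ] : Integrable f μ := by
  obtain ⟨hf, C, hC⟩ := hf
  exact Integrable.of_bound hf.aestronglyMeasurable C (ae_of_all _ hC)

theorem memLp (hf : BddMeas f) (μ : Measure α) [IsFiniteMeasure μ] (p : ENNReal) :
    MemLp f p μ := by
  obtain ⟨hf, C, hC⟩ := hf
  exact MemLp.of_bound hf.aestronglyMeasurable C (ae_of_all _ hC)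

theorem integral {f : α → I → ℂ} (hf : BddMeas (Function.uncurry f)) :
    BddMeas fun x => ∫ t : I, f x t := by
  obtain ⟨hf, C, hC⟩ := hf
  refine ⟨(hf.stronglyMeasurable.integral_prod_right (ν := volume)).measurable, C, fun x => ?_⟩
  have := norm_integral_le_of_norm_le_const (μ := (volume : Measure I))
    (ae_of_all _ fun t => hC (x, t))
  simpa using this

theorem of_continuous {f : I → ℂ} (hf : Continuous f) : BddMeas f := by
  refine ⟨hf.measurable, ?_⟩
  obtain ⟨C, hC⟩ := isCompact_univ.exists_bound_of_continuousOn hf.continuousOn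
  exact ⟨C, fun x => hC x (Set.mem_univ x)⟩

theorem integral_swap {f : I → I → ℂ} (hf : BddMeas (Function.uncurry f)) :
    ∫ t : I, ∫ s : I, f t s = ∫ s : I, ∫ t : I, f t s :=
  integral_integral_swap (hf.integrable _)

end BddMeas

/-! ### The star algebra of bounded measurable kernels -/

/-- The distributions `α δ + f` with `f` a bounded measurable function. -/
def bddDist : Set Dist0 := {d | BddMeas (Function.uncurry d.2)}

theorem bddMeas_left {f : I → I → ℂ} (hf : BddMeas (Function.uncurry f)) (t : I) :
    BddMeas fun s => f t s := hf.comp measurable_prodMk_left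

theorem bddMeas_right {f : I → I → ℂ} (hf : BddMeas (Function.uncurry f)) (s : I) :
    BddMeas fun t => f t s := hf.comp measurable_prodMk_right

theorem BddMeas.starFun {f g : I → I → ℂ} (hf : BddMeas (Function.uncurry f))
    (hg : BddMeas (Function.uncurry g)) : BddMeas (Function.uncurry (starFun f g)) := by
  refine BddMeas.integral (α := I × I) (f := fun x τ => f x.1 τ * g τ x.2) ?_
  exact (hf.comp (φ := fun x : (I × I) × I => (x.1.1, x.2)) (by fun_prop)).mul
    (hg.comp (φ := fun x : (I × I) × I => (x.2, x.1.2)) (by fun_prop))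

theorem starFun_add {f g h : I → I → ℂ} (hf : BddMeas (Function.uncurry f))
    (hg : BddMeas (Function.uncurry g)) (hh : BddMeas (Function.uncurry h)) :
    starFun f (g + h) = starFun f g + starFun f h := by
  ext t s
  simp only [starFun, Pi.add_apply, mul_add]
  exact integral_add (((bddMeas_left hf t).mul (bddMeas_right hg s)).integrable _)
    (((bddMeas_left hf t).mul (bddMeas_right hh s)).integrable _)

theorem add_starFun {f g h : I → I → ℂ} (hf : BddMeas (Function.uncurry f))
    (hg : BddMeas (Function.uncurry g)) (hh : BddMeas (Function.uncurry h)) :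
    starFun (f + g) h = starFun f h + starFun g h := by
  ext t s
  simp only [starFun, Pi.add_apply, add_mul]
  exact integral_add (((bddMeas_left hf t).mul (bddMeas_right hh s)).integrable _)
    (((bddMeas_left hg t).mul (bddMeas_right hh s)).integrable _)

theorem smul_starFun (c : ℂ) (f g : I → I → ℂ) : starFun (c • f) g = c • starFun f g := by
  ext t s
  simp only [starFun, Pi.smul_apply, smul_mul_assoc]
  exact integral_smul c _

theorem starFun_smul (c : ℂ) (f g : I → I → ℂ) : starFun f (c • g) = c • starFun f g := by
  ext t s
  simp only [starFun, Pi.smul_apply, mul_smul_comm]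
  exact integral_smul c _

theorem zero_starFun (f : I → I → ℂ) : starFun 0 f = 0 := by
  ext t s; simp [starFun]

theorem starFun_zero (f : I → I → ℂ) : starFun f 0 = 0 := by
  ext t s; simp [starFun]

theorem starFun_assoc {f g h : I → I → ℂ} (hf : BddMeas (Function.uncurry f))
    (hg : BddMeas (Function.uncurry g)) (hh : BddMeas (Function.uncurry h)) :
    starFun (starFun f g) h = starFun f (starFun g h) := by
  ext t s
  have hm : BddMeas (Function.uncurry fun τ σ => f t σ * g σ τ * h τ s) :=
    ((hf.comp (φ := fun x : I × I => (t, x.2)) (by fun_prop)).mul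
      (hg.comp (φ := fun x : I × I => (x.2, x.1)) (by fun_prop))).mul
      (hh.comp (φ := fun x : I × I => (x.1, s)) (by fun_prop))
  simp only [starFun]
  calc _ = ∫ τ : I, ∫ σ : I, f t σ * g σ τ * h τ s := by
        simp_rw [← integral_mul_const]
    _ = ∫ σ : I, ∫ τ : I, f t σ * g σ τ * h τ s := hm.integral_swap
    _ = _ := by simp_rw [← integral_const_mul, mul_assoc]

/-- An ambient algebra in which all integrals exist and Fubini applies; `D0t` inherits its laws from
here. -/
theorem isUnitalAlgebraOn_bddDist : IsUnitalAlgebraOn bddDist starMul starOne where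
  zero_mem := BddMeas.const 0
  one_mem := BddMeas.const 0
  add_mem a ha b hb := BddMeas.add ha hb
  neg_mem a ha := by
    have := BddMeas.mul (BddMeas.const (-1)) ha
    simp only [neg_one_mul] at this
    exact this
  smul_mem c a ha := (BddMeas.const c).mul ha
  mul_mem a ha b hb :=
    (((BddMeas.const a.1).mul hb).add ((BddMeas.const b.1).mul ha)).add (ha.starFun hb)
  mul_assoc a ha b hb c hc := by
    have sm : ∀ (r : ℂ) {f : I → I → ℂ}, BddMeas (Function.uncurry f) →
        BddMeas (Function.uncurry (r • f)) := fun r f hf => (BddMeas.const r).mul hf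
    have ad : ∀ {f g : I → I → ℂ}, BddMeas (Function.uncurry f) → BddMeas (Function.uncurry g) →
        BddMeas (Function.uncurry (f + g)) := fun hf hg => hf.add hg
    ext1
    · exact mul_assoc _ _ _
    · simp only [starMul]
      rw [add_starFun (ad (sm a.1 hb) (sm b.1 ha)) (ha.starFun hb) hc,
        add_starFun (sm a.1 hb) (sm b.1 ha) hc,
        starFun_add ha (ad (sm b.1 hc) (sm c.1 hb)) (hb.starFun hc),
        starFun_add ha (sm b.1 hc) (sm c.1 hb), starFun_assoc ha hb hc,
        smul_starFun, smul_starFun, starFun_smul, starFun_smul]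
      module
  one_mul a _ := by ext1 <;> simp [starMul, starOne, zero_starFun]
  mul_one a _ := by ext1 <;> simp [starMul, starOne, starFun_zero]
  mul_add a ha b hb c hc := by
    ext1
    · exact mul_add _ _ _
    · simp only [starMul, Prod.fst_add, Prod.snd_add, starFun_add ha hb hc]
      module
  add_mul a ha b hb c hc := by
    ext1
    · exact add_mul _ _ _
    · simp only [starMul, Prod.fst_add, Prod.snd_add, add_starFun ha hb hc]
      module
  smul_mul r a _ b _ := by
    ext1
    · exact smul_mul_assoc _ _ _
    · simp only [starMul, Prod.smul_fst, Prod.smul_snd, smul_starFun, smul_eq_mul]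
      module
  mul_smul r a _ b _ := by
    ext1
    · exact mul_smul_comm _ _ _
    · simp only [starMul, Prod.smul_fst, Prod.smul_snd, starFun_smul, smul_eq_mul]
      module

/-! ### The coefficient matrix of a star product -/

/-- The action of `α δ + f` on a function of the second variable. -/
def distApply (d : Dist0) (v : I → ℂ) (t : I) : ℂ := d.1 * v t + ∫ s : I, d.2 t s * v s

/-- The action of `α δ + f` on a function of the first variable. -/
def distApplyLeft (d : Dist0) (u : I → ℂ) (s : I) : ℂ := d.1 * u s + ∫ t : I, u t * d.2 t s

theorem BddMeas.distApply {d : Dist0} (hd : d ∈ bddDist) {v : I → ℂ} (hv : BddMeas v) :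
    BddMeas (distApply d v) :=
  ((BddMeas.const d.1).mul hv).add
    (BddMeas.integral (f := fun t s => d.2 t s * v s) (BddMeas.mul hd (hv.comp measurable_snd)))

theorem BddMeas.distApplyLeft {d : Dist0} (hd : d ∈ bddDist) {u : I → ℂ} (hu : BddMeas u) :
    BddMeas (distApplyLeft d u) :=
  ((BddMeas.const d.1).mul hu).add
    (BddMeas.integral (f := fun s t => u t * d.2 t s)
      ((hu.comp measurable_snd).mul (BddMeas.comp hd measurable_swap)))

/-- `distApplyLeft` is the transpose of `distApply`, by Fubini. -/
theorem integral_mul_distApply {d : Dist0} (hd : d ∈ bddDist) {u v : I → ℂ} (hu : BddMeas u)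
    (hv : BddMeas v) :
    ∫ t : I, u t * distApply d v t = ∫ s : I, distApplyLeft d u s * v s := by
  have hm : BddMeas (Function.uncurry fun t s => u t * d.2 t s * v s) :=
    ((hu.comp measurable_fst).mul hd).mul (hv.comp measurable_snd)
  simp only [distApply, distApplyLeft, mul_add, add_mul, ← integral_const_mul,
    ← integral_mul_const, ← mul_assoc]
  rw [integral_add, integral_add, hm.integral_swap]
  · simp_rw [mul_comm (u _) d.1]
  · exact (((BddMeas.const d.1).mul hu).mul hv).integrable _
  · exact (BddMeas.integral (f := fun s t => u t * d.2 t s * v s)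
      (hm.comp measurable_swap)).integrable _
  · exact ((hu.mul (BddMeas.const d.1)).mul hv).integrable _
  · exact (BddMeas.integral hm).integrable _

theorem distApply_starMul {d e : Dist0} (hd : d ∈ bddDist) (he : e ∈ bddDist) {v : I → ℂ}
    (hv : BddMeas v) : distApply (starMul d e) v = distApply d (distApply e v) := by
  ext t
  have hdt := bddMeas_left hd t
  have het := bddMeas_left he t
  have hm : BddMeas (Function.uncurry fun s τ => d.2 t τ * e.2 τ s * v s) :=
    ((BddMeas.comp hd (φ := fun x : I × I => (t, x.2)) (by fun_prop)).mul
      (BddMeas.comp he measurable_swap)).mul (hv.comp measurable_fst)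
  have hs := hm.integral_swap
  simp only [distApply, starMul, Pi.add_apply, Pi.smul_apply, smul_eq_mul, starFun]
  have h1 : ∫ s : I, (d.1 * e.2 t s + e.1 * d.2 t s + ∫ τ : I, d.2 t τ * e.2 τ s) * v s =
      d.1 * (∫ s : I, e.2 t s * v s) + e.1 * (∫ s : I, d.2 t s * v s) +
        ∫ s : I, ∫ τ : I, d.2 t τ * e.2 τ s * v s := by
    simp only [add_mul, ← integral_const_mul, ← integral_mul_const, mul_assoc]
    rw [integral_add, integral_add]
    · exact ((BddMeas.const d.1).mul (het.mul hv)).integrable _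
    · exact ((BddMeas.const e.1).mul (hdt.mul hv)).integrable _
    · exact (((BddMeas.const d.1).mul (het.mul hv)).add
        ((BddMeas.const e.1).mul (hdt.mul hv))).integrable _
    · simp only [mul_assoc] at hm
      exact (BddMeas.integral hm).integrable _
  have h2 : ∫ s : I, d.2 t s * (e.1 * v s + ∫ τ : I, e.2 s τ * v τ) =
      e.1 * (∫ s : I, d.2 t s * v s) + ∫ s : I, ∫ τ : I, d.2 t s * e.2 s τ * v τ := by
    simp only [mul_add, ← integral_const_mul, ← mul_assoc, mul_comm e.1]
    rw [integral_add]
    · rw [integral_mul_const]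
    · exact ((hdt.mul hv).mul (BddMeas.const e.1)).integrable _
    · exact (BddMeas.integral (f := fun τ s => d.2 t τ * e.2 τ s * v s)
        (hm.comp measurable_swap)).integrable _
  rw [h1, h2, hs]
  ring

theorem bddMeas_legendreP (k : ℕ) : BddMeas fun t : I => (legendreP k t : ℂ) :=
  BddMeas.of_continuous (continuous_legendreP k)

theorem coeffMatrix_eq {d : Dist0} (hd : d ∈ bddDist) (k l : ℕ) :
    coeffMatrix d k l =
      ∫ t : I, (legendreP k t : ℂ) * distApply d (fun s => (legendreP l s : ℂ)) t := by
  have hk := bddMeas_legendreP k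
  have hl := bddMeas_legendreP l
  simp only [coeffMatrix, pairing, distApply, mul_add]
  rw [integral_add]
  · congr 1
    · rw [← integral_const_mul]
      refine integral_congr_ae (ae_of_all _ fun t => ?_)
      dsimp only
      ring
    · refine integral_congr_ae (ae_of_all _ fun t => ?_)
      dsimp only
      rw [← integral_const_mul]
      refine integral_congr_ae (ae_of_all _ fun s => ?_)
      dsimp only
      ring
  · exact (hk.mul ((BddMeas.const d.1).mul hl)).integrable _
  · exact (hk.mul (BddMeas.integral (f := fun t s => d.2 t s * (legendreP l s : ℂ))
      (BddMeas.mul hd (hl.comp measurable_snd)))).integrable _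

/-- The `(k,ℓ)` entry of the product is the pairing of the transpose of `d` applied to `p_k` with
`e` applied to `p_ℓ`. Both functions are bounded, hence square integrable, and Parseval expands the
pairing over the intermediate index. -/
theorem hasSum_coeffMatrix_mul {d e : Dist0} (hd : d ∈ bddDist) (he : e ∈ bddDist) (k l : ℕ) :
    HasSum (fun j => coeffMatrix d k j * coeffMatrix e j l) (coeffMatrix (starMul d e) k l) := by
  have hk := bddMeas_legendreP k
  have hl := bddMeas_legendreP l
  have h := hasSum_legendre ((hk.distApplyLeft hd).memLp volume 2) ((hl.distApply he).memLp volume 2)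
  rw [coeffMatrix_eq (isUnitalAlgebraOn_bddDist.mul_mem d hd e he), distApply_starMul hd he hl,
    integral_mul_distApply hd hk (hl.distApply he)]
  convert! h using 2 with j
  rw [coeffMatrix_eq hd, coeffMatrix_eq he, integral_mul_distApply hd hk (bddMeas_legendreP j)]

theorem coeffMatrix_starMul {d e : Dist0} (hd : d ∈ bddDist) (he : e ∈ bddDist) :
    coeffMatrix (starMul d e) = infMul (coeffMatrix d) (coeffMatrix e) := by
  ext k l
  exact (hasSum_coeffMatrix_mul hd he k l).tsum_eq.symm

theorem mulDefined_coeffMatrix {d e : Dist0} (hd : d ∈ bddDist) (he : e ∈ bddDist) :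
    MulDefined (coeffMatrix d) (coeffMatrix e) :=
  fun k l => (hasSum_coeffMatrix_mul hd he k l).summable

theorem coeffMatrix_add {d e : Dist0} (hd : d ∈ bddDist) (he : e ∈ bddDist) :
    coeffMatrix (d + e) = coeffMatrix d + coeffMatrix e := by
  ext k l
  have hl := bddMeas_legendreP l
  have hde := isUnitalAlgebraOn_bddDist.add_mem d hd e he
  have ha : distApply (d + e) (fun s => (legendreP l s : ℂ)) = fun t =>
      distApply d (fun s => (legendreP l s : ℂ)) t +
        distApply e (fun s => (legendreP l s : ℂ)) t := by
    ext t
    simp only [distApply, Prod.fst_add, Prod.snd_add, Pi.add_apply, add_mul]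
    rw [integral_add (((bddMeas_left hd t).mul hl).integrable _)
      (((bddMeas_left he t).mul hl).integrable _)]
    ring
  have hk := bddMeas_legendreP k
  rw [Matrix.add_apply, coeffMatrix_eq hd, coeffMatrix_eq he, coeffMatrix_eq hde, ha,
    ← integral_add ((hk.mul (hl.distApply hd)).integrable _)
      ((hk.mul (hl.distApply he)).integrable _)]
  simp only [mul_add]

theorem coeffMatrix_smul (c : ℂ) (d : Dist0) : coeffMatrix (c • d) = c • coeffMatrix d := by
  ext k l
  simp only [coeffMatrix, pairing, Matrix.smul_apply, Prod.smul_fst, Prod.smul_snd,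
    Pi.smul_apply, smul_eq_mul, mul_assoc, integral_const_mul, mul_add]

theorem coeffMatrix_starOne : coeffMatrix starOne = 1 := by
  ext k l
  simp [coeffMatrix, pairing, starOne, integral_legendreP_mul_legendreP, Matrix.one_apply]

end

section

open Filter Topology
open scoped NNReal ENNReal

/-! ### Real analytic functions: antiderivatives and bounds on the derivatives -/

/-- The power series of `f` is integrated term by term from `x` to `x + z`, by dominated convergence
inside the disc of convergence. -/
theorem _root_.AnalyticAt.of_eventually_hasDerivAt {f P : ℝ → ℂ} {x : ℝ} (hf : AnalyticAt ℝ f x)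
    (hP : ∀ᶠ y in 𝓝 x, HasDerivAt P (f y) y) : AnalyticAt ℝ P x := by
  obtain ⟨p, r, hp⟩ := hf
  obtain ⟨ε, hε, hP⟩ := Metric.eventually_nhds_iff_ball.mp hP
  obtain ⟨r₁, hr₁, hr₁r⟩ := ENNReal.lt_iff_exists_nnreal_btwn.mp hp.r_pos
  have hr₁0 : (0 : ℝ) < r₁ := by exact_mod_cast hr₁
  have hsum : Summable fun n => ‖p n‖ * (r₁ : ℝ) ^ n :=
    p.summable_norm_mul_pow (hr₁r.trans_le hp.r_le)
  -- Taylor coefficients of `P`: the constant of integration, then those of `f` shifted by one and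
  -- divided by `n + 1`.
  let a : ℕ → ℂ
    | 0 => P x
    | n + 1 => ((n + 1 : ℝ)⁻¹) • p.coeff n
  let q : FormalMultilinearSeries ℝ ℝ ℂ :=
    fun n => ContinuousMultilinearMap.mkPiRing ℝ (Fin n) (a n)
  have hq (n : ℕ) : q.coeff n = a n := by simp [q, FormalMultilinearSeries.coeff]
  refine ⟨q, hasFPowerSeriesAt_iff.mpr (Metric.eventually_nhds_iff_ball.mpr ?_)⟩
  refine ⟨min ε r₁, lt_min hε hr₁0, fun z hz => ?_⟩
  rw [mem_ball_zero_iff, lt_min_iff] at hz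
  have hu : ∀ u ∈ Set.uIcc 0 z, |u| ≤ |z| := fun u hu => by
    have := Set.abs_sub_left_of_mem_uIcc hu
    simpa using this
  have hball : ∀ u ∈ Set.uIcc 0 z, x + u ∈ Metric.ball x ε := fun u h => by
    simpa using (hu u h).trans_lt hz.1
  have hser : ∀ u ∈ Set.uIcc 0 z, HasSum (fun n => u ^ n • p.coeff n) (f (x + u)) := fun u h => by
    have := hp.hasSum (y := u) (by
      rw [Metric.mem_eball, edist_zero_right]
      refine lt_of_le_of_lt ?_ hr₁r
      rw [enorm_le_coe, ← NNReal.coe_le_coe, coe_nnnorm]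
      exact (hu u h).trans hz.2.le)
    simpa [FormalMultilinearSeries.apply_eq_prod_smul_coeff] using this
  have hcont : ContinuousOn (fun u => f (x + u)) (Set.uIcc 0 z) := fun u h => by
    have hmem : u ∈ Metric.eball (0 : ℝ) r := by
      rw [Metric.mem_eball, edist_zero_right]
      refine lt_of_le_of_lt ?_ hr₁r
      rw [enorm_le_coe, ← NNReal.coe_le_coe, coe_nnnorm]
      exact (hu u h).trans hz.2.le
    have : AnalyticAt ℝ f (x + u) := hp.analyticAt_of_mem (by
      simpa [Metric.mem_eball, edist_dist, dist_eq_norm] using hmem)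
    exact (this.continuousAt.comp (f := fun u => x + u)
      (continuous_const.add continuous_id).continuousAt).continuousWithinAt
  have hint : ∫ u in (0 : ℝ)..z, f (x + u) = P (x + z) - P x := by
    have := intervalIntegral.integral_eq_sub_of_hasDerivAt (f := fun u => P (x + u))
      (f' := fun u => f (x + u)) (a := 0) (b := z)
      (fun u h => (hP _ (hball u h)).comp_const_add x u) hcont.intervalIntegrable
    simpa using this
  have key := intervalIntegral.hasSum_integral_of_dominated_convergence (μ := volume)
    (F := fun n (u : ℝ) => u ^ n • p.coeff n) (f := fun u => f (x + u)) (a := 0) (b := z)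
    (fun n _ => ‖p n‖ * (r₁ : ℝ) ^ n)
    (fun n => (by fun_prop : Continuous fun u : ℝ => u ^ n • p.coeff n).aestronglyMeasurable)
    (fun n => ae_of_all _ fun u h => by
      rw [norm_smul, norm_pow, mul_comm, FormalMultilinearSeries.norm_apply_eq_norm_coef]
      gcongr
      exact (hu u (Set.uIoc_subset_uIcc h)).trans hz.2.le)
    (ae_of_all _ fun u _ => hsum) (by simp)
    (ae_of_all _ fun u h => hser u (Set.uIoc_subset_uIcc h))
  rw [hint] at key
  -- Splitting off the constant term leaves the series of `P (x + z) - P x`, which is the integrated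
  -- one.
  rw [hasSum_nat_add_iff' 1 |>.symm]
  convert! key using 2 with n
  · rw [intervalIntegral.integral_smul_const, integral_pow, hq]
    simp [a, div_eq_mul_inv, mul_assoc]
  · simp [hq, a]

theorem exists_analytic_antiderivative {f : ℝ → ℂ} (hf : AnalyticOnNhd ℝ f (Set.Icc 0 1)) :
    ∃ P : ℝ → ℂ, AnalyticOnNhd ℝ P (Set.Icc 0 1) ∧ ∀ x ∈ Set.Icc (0 : ℝ) 1,
      HasDerivAt P (f x) x := by
  have key : ∀ x ∈ Set.Icc (0 : ℝ) 1, ∀ᶠ y in 𝓝 x,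
      HasDerivAt (fun u => ∫ v in (0 : ℝ)..u, f v) (f y) y := by
    intro x hx
    obtain ⟨ε, hε, hball⟩ := Metric.eventually_nhds_iff_ball.mp (hf x hx).eventually_analyticAt
    refine Metric.eventually_nhds_iff_ball.mpr ⟨ε, hε, fun y hy => ?_⟩
    have hsub : ∀ z ∈ Set.uIcc 0 y, AnalyticAt ℝ f z := by
      intro z hz
      -- Near an endpoint `y` may leave `[0,1]`; the segment from `0` to `y` is then covered by
      -- `[0,x]` and the small ball around `x` on which `f` is still analytic.
      rcases Set.uIcc_subset_uIcc_union_uIcc (b := x) hz with h | h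
      · rw [Set.uIcc_of_le hx.1] at h
        exact hf z ⟨h.1, h.2.trans hx.2⟩
      · exact hball z ((convex_ball x ε).ordConnected.uIcc_subset (Metric.mem_ball_self hε) hy h)
    have hc : ContinuousOn f (Set.uIcc 0 y) :=
      fun z hz => (hsub z hz).continuousAt.continuousWithinAt
    have hcb : ContinuousOn f (Metric.ball x ε) :=
      fun z hz => (hball z hz).continuousAt.continuousWithinAt
    exact intervalIntegral.integral_hasDerivAt_right hc.intervalIntegrable
      (hcb.stronglyMeasurableAtFilter Metric.isOpen_ball y hy) (hball y hy).continuousAt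
  exact ⟨_, fun x hx => (hf x hx).of_eventually_hasDerivAt (key x hx),
    fun x hx => (key x hx).self_of_nhds⟩

/-- The derivatives at a nearby `y` are `n!` times the coefficients of the series recentred at `y`.
With `r + r` below the radius of convergence, the double series of recentred coefficients converges,
and its total bounds `‖p.changeOrigin z n‖ r^n` for all `n` and all `‖z‖ ≤ r`. -/
theorem _root_.AnalyticAt.exists_iteratedDeriv_bound {f : ℝ → ℂ} {x : ℝ} (hf : AnalyticAt ℝ f x) :
    ∃ C M : ℝ, ∀ᶠ y in 𝓝 x, ∀ n : ℕ, ‖iteratedDeriv n f y‖ ≤ C * M ^ n * n.factorial := by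
  obtain ⟨p, R, hp⟩ := hf
  obtain ⟨r₂, hr₂, hr₂R⟩ := ENNReal.lt_iff_exists_nnreal_btwn.mp hp.r_pos
  have hr₂0 : 0 < r₂ := by exact_mod_cast hr₂
  set r := r₂ / 2 with hrdef
  have hr0 : 0 < r := half_pos hr₂0
  have hrr : (r + r : ℝ≥0∞) < p.radius := by
    rw [← ENNReal.coe_add, hrdef, add_halves]
    exact hr₂R.trans_le hp.r_le
  have hrR : (r : ℝ≥0∞) < R := lt_of_le_of_lt (by exact_mod_cast half_le_self hr₂0.le) hr₂R
  have hs := p.changeOriginSeries_summable_aux₁ hrr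
  obtain ⟨hs1, hs2⟩ := NNReal.summable_sigma.1 hs
  set T : ℕ → ℝ≥0 := fun n =>
    ∑' s : Σ l : ℕ, { s : Finset (Fin (n + l)) // s.card = l }, ‖p (n + s.1)‖₊ * r ^ s.1 * r ^ n
  have hT : ∀ n, T n ≤ ∑' n, T n := fun n => hs2.le_tsum n fun _ _ => zero_le
  refine ⟨(∑' n, T n : ℝ≥0), (r : ℝ)⁻¹, Metric.eventually_nhds_iff_ball.mpr
    ⟨r, hr0, fun y hy n => ?_⟩⟩
  set z := y - x
  have hz : ‖z‖₊ ≤ r := by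
    rw [Metric.mem_ball, dist_eq_norm] at hy
    exact_mod_cast hy.le
  have hzR : (‖z‖₊ : ℝ≥0∞) < R := lt_of_le_of_lt (by exact_mod_cast hz) hrR
  have hq := hp.changeOrigin hzR
  rw [add_sub_cancel] at hq
  have hfac := hq.factorial_smul 1 n
  have hbound : ‖p.changeOrigin z n‖₊ * r ^ n ≤ T n := by
    have hTn : T n = (∑' s : Σ l : ℕ, { s : Finset (Fin (n + l)) // s.card = l },
        ‖p (n + s.1)‖₊ * r ^ s.1) * r ^ n := NNReal.tsum_mul_right _ _
    rw [hTn]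
    gcongr
    refine (p.nnnorm_changeOrigin_le n (hzR.trans_le hp.r_le)).trans ?_
    have hsr := p.changeOriginSeries_summable_aux₂ (hrR.trans_le hp.r_le) n
    refine Summable.tsum_le_tsum (fun s => by gcongr) ?_ hsr
    exact NNReal.summable_of_le (fun s => by gcongr) hsr
  have hb' : ‖p.changeOrigin z n‖ * (r : ℝ) ^ n ≤ (∑' n, T n : ℝ≥0) := by
    exact_mod_cast hbound.trans (hT n)
  rw [iteratedDeriv_eq_iteratedFDeriv]
  have hfac' : iteratedFDeriv ℝ n f y (fun _ => 1) = (n.factorial : ℝ) •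
      (p.changeOrigin z n fun _ => 1) := by
    rw [Nat.cast_smul_eq_nsmul]; exact hfac.symm
  rw [hfac', norm_smul, Real.norm_natCast, mul_comm]
  gcongr
  calc ‖p.changeOrigin z n fun _ => 1‖ ≤ ‖p.changeOrigin z n‖ := by
        simp
    _ ≤ _ := by
        rw [inv_pow, ← div_eq_mul_inv, le_div_iff₀ (by positivity)]
        exact hb'

theorem exists_iteratedDeriv_bound_of_isCompact {f : ℝ → ℂ} {s : Set ℝ} (hs : IsCompact s)
    (hf : AnalyticOnNhd ℝ f s) :
    ∃ C M : ℝ, 0 ≤ C ∧ 1 ≤ M ∧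
      ∀ y ∈ s, ∀ n : ℕ, ‖iteratedDeriv n f y‖ ≤ C * M ^ n * n.factorial := by
  refine hs.induction_on (p := fun s => ∃ C M : ℝ, 0 ≤ C ∧ 1 ≤ M ∧
      ∀ y ∈ s, ∀ n : ℕ, ‖iteratedDeriv n f y‖ ≤ C * M ^ n * n.factorial) ?_ ?_ ?_ ?_
  · exact ⟨0, 1, le_rfl, le_rfl, by simp⟩
  · rintro s t hst ⟨C, M, hC, hM, h⟩
    exact ⟨C, M, hC, hM, fun y hy => h y (hst hy)⟩
  · rintro s t ⟨C, M, hC, hM, h⟩ ⟨D, L, hD, hL, h'⟩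
    have hM0 := zero_le_one.trans hM
    have hL0 := zero_le_one.trans hL
    refine ⟨max C D, max M L, hC.trans (le_max_left _ _), hM.trans (le_max_left _ _), ?_⟩
    rintro y (hy | hy) n
    · refine (h y hy n).trans ?_
      gcongr <;> exact le_max_left _ _
    · refine (h' y hy n).trans ?_
      gcongr <;> exact le_max_right _ _
  · intro x hx
    obtain ⟨C, M, h⟩ := (hf x hx).exists_iteratedDeriv_bound
    refine ⟨_, mem_nhdsWithin_of_mem_nhds h, |C|, max |M| 1, abs_nonneg _, le_max_right _ _,
      fun y hy n => (hy n).trans (mul_le_mul_of_nonneg_right ?_ (Nat.cast_nonneg _))⟩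
    calc C * M ^ n ≤ |C * M ^ n| := le_abs_self _
      _ = |C| * |M| ^ n := by rw [abs_mul, abs_pow]
      _ ≤ _ := by gcongr; exact le_max_left _ _

end

section

open Filter Topology Polynomial

/-! ### Geometric decay of the Fourier coefficients of analytic periodic functions -/

/-- The Fourier coefficients of a function of period one. -/
def fourierInt (g : ℝ → ℂ) (k : ℤ) : ℂ :=
  ∫ x in (0 : ℝ)..1, Complex.exp (-(2 * Real.pi * k * x * Complex.I)) * g x

theorem norm_fourierInt_le {g : ℝ → ℂ} {B : ℝ} (hB : ∀ x ∈ Set.Icc (0 : ℝ) 1, ‖g x‖ ≤ B) (k : ℤ) :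
    ‖fourierInt g k‖ ≤ B := by
  have := intervalIntegral.norm_integral_le_of_norm_le_const (a := (0 : ℝ)) (b := 1) (C := B)
    (f := fun x : ℝ => Complex.exp (-(2 * Real.pi * k * x * Complex.I)) * g x) (fun x hx => by
      rw [Set.uIoc_of_le zero_le_one] at hx
      have h : ‖Complex.exp (-(2 * Real.pi * k * x * Complex.I))‖ = 1 := by
        rw [show -(2 * Real.pi * k * x * Complex.I) =
          ((-(2 * Real.pi * k * x) : ℝ) : ℂ) * Complex.I by push_cast; ring]
        exact Complex.norm_exp_ofReal_mul_I _
      rw [norm_mul, h, one_mul]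
      exact hB x ⟨hx.1.le, hx.2⟩)
  simpa [fourierInt] using this

theorem fourierInt_deriv {g g' : ℝ → ℂ} (hg : ∀ x, HasDerivAt g (g' x) x) (hg' : Continuous g')
    (hper : g 1 = g 0) (k : ℤ) :
    fourierInt g' k = (2 * Real.pi * k * Complex.I) * fourierInt g k := by
  set c : ℂ := -(2 * Real.pi * k * Complex.I) with hc
  have he : ∀ x : ℝ, HasDerivAt (fun x : ℝ => Complex.exp (c * x)) (Complex.exp (c * x) * c) x :=
    fun x => by
      have h1 : HasDerivAt (fun x : ℝ => c * (x : ℂ)) c x := by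
        simpa using (Complex.ofRealCLM.hasDerivAt (x := x)).const_mul c
      exact h1.cexp
  have h := intervalIntegral.integral_mul_deriv_eq_deriv_mul (a := (0 : ℝ)) (b := 1)
    (fun x _ => he x) (fun x _ => hg x)
    ((by fun_prop : Continuous fun x : ℝ => Complex.exp (c * x) * c).intervalIntegrable _ _)
    (hg'.intervalIntegrable _ _)
  have e1 : Complex.exp (c * ((1 : ℝ) : ℂ)) = 1 := by
    rw [Complex.exp_eq_one_iff]
    exact ⟨-k, by push_cast; rw [hc]; ring⟩
  have hF : ∀ f : ℝ → ℂ, fourierInt f k = ∫ x in (0 : ℝ)..1, Complex.exp (c * x) * f x := by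
    intro f
    simp only [fourierInt, hc]
    congr! 4 with x
    ring
  rw [hF, hF, h, e1, hper]
  simp only [Complex.ofReal_zero, mul_zero, Complex.exp_zero, sub_self, zero_sub]
  rw [← intervalIntegral.integral_neg, ← intervalIntegral.integral_const_mul]
  refine intervalIntegral.integral_congr fun x _ => ?_
  simp only [hc]
  ring

theorem fourierInt_iteratedDeriv {g : ℝ → ℂ} (hg : AnalyticOnNhd ℝ g Set.univ)
    (hper : Function.Periodic g 1) (k : ℤ) (n : ℕ) :
    fourierInt (iteratedDeriv n g) k = (2 * Real.pi * k * Complex.I) ^ n * fourierInt g k := by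
  have han : ∀ n, AnalyticOnNhd ℝ (iteratedDeriv n g) Set.univ := fun n => by
    rw [iteratedDeriv_eq_iterate]; exact hg.iterated_deriv n
  have hp : ∀ n, Function.Periodic (iteratedDeriv n g) 1 := fun n x => by
    have := congrFun (iteratedDeriv_comp_add_const n g 1) x
    rw [← this]
    congr 1
    exact funext hper
  induction n with
  | zero => simp
  | succ n ih =>
    have hd : ∀ x, HasDerivAt (iteratedDeriv n g) (iteratedDeriv (n + 1) g x) x := fun x => by
      rw [iteratedDeriv_succ]
      exact (han n x trivial).differentiableAt.hasDerivAt
    rw [fourierInt_deriv hd (han (n + 1)).continuous (by simpa using hp n 0), ih, pow_succ]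
    ring

/-- Integrating by parts `n` times gives `(2π|k|)^n |c_k| ≤ C M^n n! ≤ C (nL)^n` for an integer `L ≥
M`. Taking `n` to be the integer part of `|k|/(2L)` makes `nL ≤ |k|/2`, hence `|c_k| ≤ C 2^(-n)`. -/
theorem exists_fourierInt_bound {g : ℝ → ℂ} (hg : AnalyticOnNhd ℝ g Set.univ)
    (hper : Function.Periodic g 1) :
    ∃ C r : ℝ, 0 ≤ C ∧ 0 < r ∧ r < 1 ∧ ∀ k : ℤ, ‖fourierInt g k‖ ≤ C * r ^ k.natAbs := by
  obtain ⟨C, M, hC, hM, h⟩ := exists_iteratedDeriv_bound_of_isCompact isCompact_Icc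
    (hg.mono (Set.subset_univ (Set.Icc 0 1)))
  obtain ⟨L, hL⟩ := exists_nat_ge M
  have hL1 : 1 ≤ L := by exact_mod_cast hM.trans hL
  -- Chosen so that `r^(2L) = 1/2`; then `2^(-n)` is at most `2 r^|k|`, the factor `2` paying for
  -- the rounding in `n`.
  set r : ℝ := (1 / 2 : ℝ) ^ ((2 * L : ℕ) : ℝ)⁻¹ with hr
  have hr0 : 0 < r := Real.rpow_pos_of_pos (by norm_num) _
  have hrL : r ^ (2 * L) = 1 / 2 := Real.rpow_inv_natCast_pow (by norm_num) (by omega)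
  have hr1 : r < 1 := Real.rpow_lt_one (by norm_num) (by norm_num) (by positivity)
  refine ⟨2 * C, r, by positivity, hr0, hr1, fun k => ?_⟩
  set m := k.natAbs with hm
  set n := m / (2 * L) with hn
  have hmn : m < 2 * L * (n + 1) := Nat.lt_mul_div_succ m (by omega)
  have hnm : n * (2 * L) ≤ m := Nat.div_mul_le_self _ _
  have hpow : (1 / 2 : ℝ) ^ n ≤ 2 * r ^ m := by
    have h1 : r ^ (2 * L * (n + 1)) ≤ r ^ m := pow_le_pow_of_le_one hr0.le hr1.le hmn.le
    rw [pow_mul, hrL, pow_succ] at h1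
    linarith
  suffices hmain : ‖fourierInt g k‖ ≤ C * (1 / 2 : ℝ) ^ n by
    calc _ ≤ C * (1 / 2 : ℝ) ^ n := hmain
      _ ≤ C * (2 * r ^ m) := by gcongr
      _ = _ := by ring
  have hb := norm_fourierInt_le (fun x hx => h x hx n) k
  rw [fourierInt_iteratedDeriv hg hper, norm_mul, norm_pow] at hb
  rcases Nat.eq_zero_or_pos m with h0 | h0
  · have : n = 0 := by rw [hn, h0]; simp
    simpa [this] using hb
  have hk : ‖(2 * Real.pi * k * Complex.I : ℂ)‖ = 2 * Real.pi * m := by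
    simp [hm, abs_of_pos Real.pi_pos, Nat.cast_natAbs]
  have hmpos : (0 : ℝ) < m := by exact_mod_cast h0
  have hkm : (m : ℝ) ≤ 2 * Real.pi * m := by nlinarith [Real.pi_gt_three]
  rw [hk] at hb
  have hfac : (n.factorial : ℝ) ≤ (n : ℝ) ^ n := by exact_mod_cast Nat.factorial_le_pow n
  have hL0 : (0 : ℝ) < L := by exact_mod_cast hL1
  have h3 : (m : ℝ) ^ n * ‖fourierInt g k‖ ≤ (m : ℝ) ^ n * (C * (1 / 2 : ℝ) ^ n) := by
    calc (m : ℝ) ^ n * ‖fourierInt g k‖ ≤ (2 * Real.pi * m) ^ n * ‖fourierInt g k‖ := by gcongr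
      _ ≤ C * M ^ n * n.factorial := hb
      _ ≤ C * (L : ℝ) ^ n * (n : ℝ) ^ n := by gcongr
      _ = C * (n * L : ℝ) ^ n := by rw [mul_pow]; ring
      _ ≤ C * (m * (1 / 2) : ℝ) ^ n := by
        refine mul_le_mul_of_nonneg_left (pow_le_pow_left₀ (by positivity) ?_ n) hC
        have : ((n * (2 * L) : ℕ) : ℝ) ≤ m := by exact_mod_cast hnm
        push_cast at this
        linarith
      _ = _ := by rw [mul_pow]; ring
  exact le_of_mul_le_mul_left h3 (by positivity)

theorem hasSum_fourierInt {g : ℝ → ℂ} (hg : Continuous g) (hper : Function.Periodic g 1)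
    (hs : Summable (fourierInt g)) (x : ℝ) :
    HasSum (fun k : ℤ => fourierInt g k * Complex.exp (2 * Real.pi * k * x * Complex.I)) (g x) := by
  let G : C(AddCircle (1 : ℝ), ℂ) :=
    ⟨hper.lift, continuous_coinduced_dom.mpr hg⟩
  have hc : fourierCoeff G = fourierInt g := by
    ext k
    rw [fourierCoeff_eq_intervalIntegral _ _ 0]
    simp only [fourierInt, div_one, one_smul, zero_add]
    refine intervalIntegral.integral_congr fun y _ => ?_
    rw [fourier_coe_apply, smul_eq_mul]
    congr 2
    push_cast
    ring
  have := has_pointwise_sum_fourier_series_of_summable (f := G) (by rwa [hc])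
    (x : AddCircle (1 : ℝ))
  rw [hc] at this
  convert! this using 2 with k
  rw [fourier_coe_apply, smul_eq_mul]
  congr 2
  push_cast
  ring

/-! ### Geometric approximation of analytic functions by polynomials -/

theorem summable_pow_natAbs {r : ℝ} (h0 : 0 < r) (h1 : r < 1) :
    Summable fun k : ℤ => r ^ k.natAbs := by
  have := summable_geometric_of_lt_one h0.le h1
  exact Summable.of_nat_of_neg (by simpa using this) (by simpa using this)

/-- Under `2x - 1 = cos 2πθ` the polynomial `T_k(2x - 1)` becomes `cos(2πkθ)`, so truncating the
Fourier series of the lifted function at `|k| ≤ n` is a polynomial approximation of degree at most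
`n`. -/
theorem exists_polynomial_approx {f : ℝ → ℂ} (hf : AnalyticOnNhd ℝ f (Set.Icc 0 1)) :
    ∃ B r : ℝ, 0 < B ∧ 0 < r ∧ r < 1 ∧ ∀ n : ℕ, ∃ q : ℂ[X], q.natDegree ≤ n ∧
      ∀ x ∈ Set.Icc (0 : ℝ) 1, ‖f x - q.eval (x : ℂ)‖ ≤ B * r ^ n := by
  set φ : ℝ → ℝ := fun θ => (1 + Real.cos (2 * Real.pi * θ)) / 2 with hφ
  have hφan : AnalyticOnNhd ℝ φ Set.univ := fun θ _ => by
    have : AnalyticAt ℝ Real.cos (2 * Real.pi * θ) := Real.analyticAt_cos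
    exact (analyticAt_const.add (this.fun_comp (analyticAt_const.mul analyticAt_id))).div_const
  have hφmem : ∀ θ, φ θ ∈ Set.Icc (0 : ℝ) 1 := fun θ => by
    have h1 := Real.neg_one_le_cos (2 * Real.pi * θ)
    have h2 := Real.cos_le_one (2 * Real.pi * θ)
    constructor <;> simp only [hφ] <;> linarith
  have hgan : AnalyticOnNhd ℝ (fun θ => f (φ θ)) Set.univ := fun θ _ =>
    (hf _ (hφmem θ)).fun_comp (hφan θ trivial)
  have hper : Function.Periodic (fun θ => f (φ θ)) 1 := fun θ => by
    simp only [hφ]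
    rw [show 2 * Real.pi * (θ + 1) = 2 * Real.pi * θ + 2 * Real.pi by ring, Real.cos_add_two_pi]
  set g : ℝ → ℂ := fun θ => f (φ θ) with hg
  obtain ⟨B, r, hB, hr0, hr1, hb⟩ := exists_fourierInt_bound hgan hper
  have hsum : Summable (fourierInt g) :=
    Summable.of_norm_bounded ((summable_pow_natAbs hr0 hr1).mul_left B) hb
  have hcos : ∀ θ : ℝ, HasSum (fun k : ℤ => fourierInt g k * Complex.cos (k * (2 * Real.pi * θ)))
      (g θ) := fun θ => by
    have h1 := hasSum_fourierInt hgan.continuous hper hsum θ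
    have h2 := hasSum_fourierInt hgan.continuous hper hsum (-θ)
    have he : g (-θ) = g θ := by simp [hg, hφ]
    rw [he] at h2
    convert! (h1.add h2).div_const 2 using 1
    · ext k
      rw [Complex.cos, ← mul_add, mul_div_assoc]
      congr 4
      · ring
      · push_cast; ring
    · ring
  set s := Real.sqrt r with hs
  have hs0 : 0 < s := Real.sqrt_pos.mpr hr0
  have hs1 : s < 1 := by rw [hs, Real.sqrt_lt' one_pos]; simpa using hr1
  have hss : s ^ 2 = r := Real.sq_sqrt hr0.le
  set K : ℝ := ∑' k : ℤ, s ^ k.natAbs with hK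
  have hsumS := summable_pow_natAbs hs0 hs1
  have hK0 : 0 ≤ K := tsum_nonneg fun k => by positivity
  refine ⟨B * K + 1, s, by positivity, hs0, hs1, fun n => ?_⟩
  set S : Finset ℤ := Finset.Icc (-(n : ℤ)) n with hS
  refine ⟨∑ k ∈ S, Polynomial.C (fourierInt g k) * (Chebyshev.T ℂ k).comp (2 * X - 1), ?_, ?_⟩
  · refine natDegree_sum_le_of_forall_le _ _ fun k hk => ?_
    refine (natDegree_C_mul_le _ _).trans (natDegree_comp_le.trans ?_)
    have h1 : (2 * X - 1 : ℂ[X]).natDegree ≤ 1 := by compute_degree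
    rw [Chebyshev.natDegree_T]
    rw [hS, Finset.mem_Icc] at hk
    calc k.natAbs * (2 * X - 1 : ℂ[X]).natDegree ≤ k.natAbs * 1 := by gcongr
      _ ≤ n := by omega
  · intro x hx
    set θ := Real.arccos (2 * x - 1) / (2 * Real.pi) with hθ
    have hθ' : 2 * Real.pi * θ = Real.arccos (2 * x - 1) := by
      rw [hθ]; field_simp
    have hcx : Real.cos (2 * Real.pi * θ) = 2 * x - 1 := by
      rw [hθ', Real.cos_arccos (by linarith [hx.1]) (by linarith [hx.2])]
    have hgx : g θ = f x := by simp only [hg, hφ, hcx]; congr 1; ring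
    have hT : ∀ k : ℤ, ((Chebyshev.T ℂ k).comp (2 * X - 1)).eval (x : ℂ) =
        Complex.cos (k * (2 * Real.pi * θ)) := fun k => by
      rw [← Chebyshev.T_complex_cos, eval_comp]
      congr 1
      have := congrArg (fun y : ℝ => (y : ℂ)) hcx
      push_cast at this
      rw [this]
      simp
    have hreal : ∀ k : ℤ, ‖Complex.cos (k * (2 * Real.pi * θ))‖ ≤ 1 := fun k => by
      rw [show (k * (2 * Real.pi * θ) : ℂ) = ((k * (2 * Real.pi * θ) : ℝ) : ℂ) by push_cast; ring,
        ← Complex.ofReal_cos, Complex.norm_real]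
      exact Real.abs_cos_le_one _
    have h1 := hcos θ
    have h2 : HasSum (fun k =>
          if k ∈ S then fourierInt g k * Complex.cos (k * (2 * Real.pi * θ)) else 0)
        (∑ k ∈ S, if k ∈ S then fourierInt g k * Complex.cos (k * (2 * Real.pi * θ)) else 0) :=
      hasSum_sum_of_ne_finset_zero fun k hk => if_neg hk
    have h3 := h1.sub h2
    rw [hgx] at h3
    have hev : (∑ k ∈ S, Polynomial.C (fourierInt g k) * (Chebyshev.T ℂ k).comp (2 * X - 1)).eval
        (x : ℂ) = ∑ k ∈ S, if k ∈ S then fourierInt g k * Complex.cos (k * (2 * Real.pi * θ)) else 0 := by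
      rw [eval_finsetSum]
      refine Finset.sum_congr rfl fun k hk => ?_
      rw [if_pos hk, eval_mul, eval_C, hT]
    rw [hev, ← h3.tsum_eq]
    have hbd := tsum_of_norm_bounded (g := fun k : ℤ => B * s ^ n * s ^ k.natAbs)
      (hsumS.hasSum.mul_left (B * s ^ n)) (f := fun k : ℤ =>
        fourierInt g k * Complex.cos (k * (2 * Real.pi * θ)) -
          if k ∈ S then fourierInt g k * Complex.cos (k * (2 * Real.pi * θ)) else 0) fun k => by
      split_ifs with hk
      · rw [sub_self, norm_zero]; positivity
      · rw [sub_zero, norm_mul]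
        have hnk : n ≤ k.natAbs := by rw [hS, Finset.mem_Icc] at hk; omega
        calc _ ≤ B * r ^ k.natAbs * 1 := by
              gcongr
              · exact hb k
              · exact hreal k
          _ = B * (s ^ k.natAbs * s ^ k.natAbs) := by rw [← hss, ← pow_mul]; ring
          _ ≤ B * (s ^ n * s ^ k.natAbs) := by
              have := pow_le_pow_of_le_one hs0.le hs1.le hnk
              gcongr
          _ = _ := by ring
    refine hbd.trans ?_
    have : 0 < s ^ n := by positivity
    change B * s ^ n * K ≤ _
    nlinarith

end

section

open Filter Topology Polynomial

/-! ### Separable kernels -/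

theorem measurable_heaviside : Measurable heaviside :=
  Measurable.ite measurableSet_Ici measurable_const measurable_const

theorem norm_heaviside_le (x : ℝ) : ‖heaviside x‖ ≤ 1 := by
  unfold heaviside; split_ifs <;> simp

theorem bddMeas_heaviside : BddMeas heaviside := ⟨measurable_heaviside, 1, norm_heaviside_le⟩

theorem bddMeas_heaviside_sub :
    BddMeas (Function.uncurry fun t s : I => heaviside ((t : ℝ) - s)) :=
  bddMeas_heaviside.comp (φ := fun x : I × I => (x.1 : ℝ) - x.2) (by fun_prop)

theorem integral_heaviside_mul {F P : ℝ → ℂ} (hF : ContinuousOn F (Set.Icc 0 1))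
    (hP : ∀ x ∈ Set.Icc (0 : ℝ) 1, HasDerivAt P (F x) x) (t s : I) :
    ∫ τ : I, heaviside ((t : ℝ) - τ) * F τ * heaviside ((τ : ℝ) - s) =
      (P t - P s) * heaviside ((t : ℝ) - s) := by
  have h1 : ∀ τ : ℝ, heaviside ((t : ℝ) - τ) * F τ * heaviside (τ - s) =
      (Set.Icc (s : ℝ) t).indicator F τ := fun τ => by
    simp only [heaviside, sub_nonneg, Set.indicator_apply, Set.mem_Icc]
    by_cases h : τ ≤ t <;> by_cases h' : (s : ℝ) ≤ τ <;> simp [h, h']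
  have hsub : Set.Icc (s : ℝ) t ⊆ Set.Icc 0 1 := Set.Icc_subset_Icc s.2.1 t.2.2
  rw [integral_unitInterval fun τ : ℝ => heaviside ((t : ℝ) - τ) * F τ * heaviside (τ - s)]
  simp only [h1]
  rw [intervalIntegral.integral_of_le zero_le_one, ← integral_Icc_eq_integral_Ioc,
    setIntegral_indicator measurableSet_Icc, Set.inter_eq_right.mpr hsub]
  by_cases h : (s : ℝ) ≤ t
  · rw [integral_Icc_eq_integral_Ioc, ← intervalIntegral.integral_of_le h,
      intervalIntegral.integral_eq_sub_of_hasDerivAt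
        (fun x hx => hP x (hsub (Set.uIcc_of_le h ▸ hx)))
        ((hF.mono (Set.uIcc_of_le h ▸ hsub)).intervalIntegrable)]
    simp [heaviside, h]
  · rw [Set.Icc_eq_empty h]
    simp [heaviside, h]

/-- The functions `a(t) b(s) Θ(t-s)` with `a` and `b` analytic over `[0,1]`. -/
def sepKernels : Set (I → I → ℂ) :=
  {f | ∃ a b : ℝ → ℂ, AnalyticOnNhd ℝ a (Set.Icc 0 1) ∧ AnalyticOnNhd ℝ b (Set.Icc 0 1) ∧
      ∀ t s : I, f t s = a t * b s * heaviside ((t : ℝ) - s)}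

theorem _root_.AnalyticOnNhd.bddMeas {a : ℝ → ℂ} (ha : AnalyticOnNhd ℝ a (Set.Icc 0 1)) :
    BddMeas fun t : I => a t :=
  BddMeas.of_continuous (continuousOn_iff_continuous_domRestrict.mp ha.continuousOn)

theorem bddMeas_of_mem_sepKernels {f : I → I → ℂ} (hf : f ∈ sepKernels) :
    BddMeas (Function.uncurry f) := by
  obtain ⟨a, b, ha, hb, h⟩ := hf
  obtain rfl : f = fun (t s : I) => a t * b s * heaviside ((t : ℝ) - s) :=
    funext fun t => funext fun s => h t s
  exact ((ha.bddMeas.comp measurable_fst).mul (hb.bddMeas.comp measurable_snd)).mul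
    bddMeas_heaviside_sub

theorem bddMeas_of_mem_span {f : I → I → ℂ} (hf : f ∈ Submodule.span ℂ sepKernels) :
    BddMeas (Function.uncurry f) := by
  induction hf using Submodule.span_induction with
  | mem f hf => exact bddMeas_of_mem_sepKernels hf
  | zero => exact BddMeas.const 0
  | add f g _ _ hf hg => exact hf.add hg
  | smul c f _ hf => exact (BddMeas.const c).mul hf

theorem mem_ATheta_of_mem_span {f : I → I → ℂ} (hf : f ∈ Submodule.span ℂ sepKernels) :
    f ∈ ATheta := by
  induction hf using Submodule.span_induction with
  | mem f hf =>
    obtain ⟨a, b, ha, hb, h⟩ := hf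
    exact ⟨fun t s => a t * b s, fun z hz => ((ha z.1 hz.1).fun_comp analyticAt_fst).mul
      ((hb z.2 hz.2).fun_comp analyticAt_snd), h⟩
  | zero => exact ⟨fun _ _ => 0, fun _ _ => analyticAt_const, by simp⟩
  | add f g _ _ hf hg =>
    obtain ⟨f', hf', hf⟩ := hf
    obtain ⟨g', hg', hg⟩ := hg
    exact ⟨fun t s => f' t s + g' t s, fun z hz => (hf' z hz).add (hg' z hz),
      fun t s => by rw [Pi.add_apply, Pi.add_apply, hf, hg, add_mul]⟩
  | smul c f _ hf =>
    obtain ⟨f', hf', hf⟩ := hf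
    exact ⟨fun t s => c * f' t s, fun z hz => analyticAt_const.mul (hf' z hz),
      fun t s => by rw [Pi.smul_apply, Pi.smul_apply, hf, smul_eq_mul, mul_assoc]⟩

theorem starFun_mem_span {f g : I → I → ℂ} (hf : f ∈ Submodule.span ℂ sepKernels)
    (hg : g ∈ Submodule.span ℂ sepKernels) : starFun f g ∈ Submodule.span ℂ sepKernels := by
  induction hf, hg using Submodule.span_induction₂ with
  | mem_mem f g hf hg =>
    obtain ⟨a, b, ha, hb, hf⟩ := hf
    obtain ⟨c, d, hc, hd, hg⟩ := hg
    obtain ⟨P, hPan, hP⟩ := exists_analytic_antiderivative (hb.mul hc)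
    have e : starFun f g = (fun t s : I => (a t * P t) * d s * heaviside ((t : ℝ) - s)) -
        fun t s : I => a t * (P s * d s) * heaviside ((t : ℝ) - s) := by
      ext t s
      have h := integral_heaviside_mul (hb.mul hc).continuousOn hP t s
      have h2 : ∀ τ : I, f t τ * g τ s = (a t * d s) *
          (heaviside ((t : ℝ) - τ) * (b τ * c τ) * heaviside ((τ : ℝ) - s)) := fun τ => by
        rw [hf, hg]; ring
      simp only [starFun, h2, integral_const_mul, h, Pi.sub_apply]
      ring
    rw [e]
    exact Submodule.sub_mem _
      (Submodule.subset_span ⟨fun t => a t * P t, d, ha.mul hPan, hd, fun _ _ => rfl⟩)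
      (Submodule.subset_span ⟨a, fun s => P s * d s, ha, hPan.mul hd, fun _ _ => rfl⟩)
  | zero_left g hg => rw [zero_starFun]; exact Submodule.zero_mem _
  | zero_right f hf => rw [starFun_zero]; exact Submodule.zero_mem _
  | add_left f g h hf hg hh h1 h2 =>
    rw [add_starFun (bddMeas_of_mem_span hf) (bddMeas_of_mem_span hg) (bddMeas_of_mem_span hh)]
    exact Submodule.add_mem _ h1 h2
  | add_right f g h hf hg hh h1 h2 =>
    rw [starFun_add (bddMeas_of_mem_span hf) (bddMeas_of_mem_span hg) (bddMeas_of_mem_span hh)]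
    exact Submodule.add_mem _ h1 h2
  | smul_left r f g _ _ h => rw [smul_starFun]; exact Submodule.smul_mem _ _ h
  | smul_right r f g _ _ h => rw [starFun_smul]; exact Submodule.smul_mem _ _ h

/-! ### Geometric decay -/

theorem HasGeometricDecay.add {F G : InfMat} (hF : HasGeometricDecay F)
    (hG : HasGeometricDecay G) : HasGeometricDecay (F + G) := by
  obtain ⟨K, ρ, hK, h0, h1, h⟩ := hF
  obtain ⟨K', ρ', hK', h0', h1', h'⟩ := hG
  refine ⟨K + K', max ρ ρ', by positivity, lt_max_of_lt_left h0, max_lt h1 h1', fun k l => ?_⟩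
  rw [add_mul]
  refine norm_add_le_of_le ((h k l).trans ?_) ((h' k l).trans ?_)
  · gcongr; exact le_max_left _ _
  · gcongr; exact le_max_right _ _

theorem HasGeometricDecay.smul {F : InfMat} (hF : HasGeometricDecay F) (c : ℂ) :
    HasGeometricDecay (c • F) := by
  obtain ⟨K, ρ, hK, h0, h1, h⟩ := hF
  refine ⟨(‖c‖ + 1) * K, ρ, by positivity, h0, h1, fun k l => ?_⟩
  rw [Matrix.smul_apply, norm_smul, mul_assoc]
  gcongr
  · linarith
  · exact h k l

theorem hasGeometricDecay_one : HasGeometricDecay 1 := by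
  refine ⟨1, 1 / 2, one_pos, by norm_num, by norm_num, fun k l => ?_⟩
  rw [Matrix.one_apply]
  split_ifs with h
  · simp [h]
  · rw [norm_zero]; positivity

theorem HasGeometricDecay.zero : HasGeometricDecay 0 := by
  simpa using hasGeometricDecay_one.smul 0

theorem norm_integral_mul_legendreP_le {u : I → ℂ} {E : ℝ} (h : ∀ t, ‖u t‖ ≤ E) (k : ℕ) :
    ‖∫ t : I, u t * legendreP k t‖ ≤ E := by
  have hE : 0 ≤ E := (norm_nonneg _).trans (h 0)
  have hc : Continuous fun t : I => legendreP k t :=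
    Complex.continuous_re.comp (continuous_legendreP k)
  have hc2 : Continuous fun t : I => legendreP k t ^ 2 := hc.pow 2
  have h2 : ∫ t : I, legendreP k t ^ 2 = 1 := by
    have := integral_legendreP_mul_legendreP k k
    rw [if_pos rfl] at this
    simp only [← sq, ← Complex.ofReal_pow] at this
    rw [integral_complex_ofReal] at this
    exact_mod_cast this
  have hb : ∫ t : I, E * ((1 + legendreP k t ^ 2) / 2) = E := by
    rw [integral_const_mul, integral_div, integral_add (integrable_const _)
      (integrable_of_continuous hc2), h2]
    simp
  rw [← hb]
  refine norm_integral_le_of_norm_le (integrable_of_continuous (by fun_prop))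
    (ae_of_all _ fun t => ?_)
  rw [norm_mul, Complex.norm_real, Real.norm_eq_abs]
  have h3 : |legendreP k t| ≤ (1 + legendreP k t ^ 2) / 2 := by
    rw [← sq_abs]; nlinarith [sq_nonneg (|legendreP k t| - 1)]
  exact mul_le_mul (h t) h3 (abs_nonneg _) hE

theorem coeffMatrix_ofFun {f : I → I → ℂ} (hf : BddMeas (Function.uncurry f)) (k l : ℕ) :
    coeffMatrix (ofFun f) k l = ∫ t : I, (∫ s : I, f t s * legendreP l s) * legendreP k t := by
  rw [coeffMatrix_eq (d := ofFun f) hf]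
  simp [distApply, ofFun, mul_comm]

theorem coeffMatrix_ofFun' {f : I → I → ℂ} (hf : BddMeas (Function.uncurry f)) (k l : ℕ) :
    coeffMatrix (ofFun f) k l = ∫ s : I, (∫ t : I, f t s * legendreP k t) * legendreP l s := by
  rw [coeffMatrix_eq (d := ofFun f) hf, integral_mul_distApply (d := ofFun f) hf
    (bddMeas_legendreP k) (bddMeas_legendreP l)]
  simp [distApplyLeft, ofFun, mul_comm]

theorem norm_coeffMatrix_ofFun_le {f : I → I → ℂ} (hf : BddMeas (Function.uncurry f)) {E : ℝ}
    (h : ∀ t s, ‖f t s‖ ≤ E) (k l : ℕ) : ‖coeffMatrix (ofFun f) k l‖ ≤ E := by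
  rw [coeffMatrix_ofFun hf]
  exact norm_integral_mul_legendreP_le (fun t => norm_integral_mul_legendreP_le (h t) l) k

theorem exists_polynomial_antiderivative (p : ℂ[X]) :
    ∃ P : ℂ[X], derivative P = p ∧ P.natDegree ≤ p.natDegree + 1 := by
  refine ⟨∑ i ∈ Finset.range (p.natDegree + 1), monomial (i + 1) (p.coeff i / (i + 1)), ?_, ?_⟩
  · conv_rhs => rw [p.as_sum_range]
    rw [derivative_sum]
    refine Finset.sum_congr rfl fun i _ => ?_
    rw [derivative_monomial]
    congr 1
    push_cast
    exact div_mul_cancel₀ _ (Nat.cast_add_one_ne_zero i)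
  · refine natDegree_sum_le_of_forall_le _ _ fun i hi => (natDegree_monomial_le _).trans ?_
    rw [Finset.mem_range] at hi
    omega

theorem analyticOnNhd_eval (q : ℂ[X]) (s : Set ℝ) :
    AnalyticOnNhd ℝ (fun x : ℝ => q.eval (x : ℂ)) s := fun x _ => by
  have h : AnalyticAt ℝ (fun z : ℂ => q.eval z) (x : ℂ) := by
    have : AnalyticAt ℂ (fun z : ℂ => aeval z q) (x : ℂ) := analyticAt_id.aeval_polynomial q
    simpa using this.restrictScalars
  exact h.fun_comp (Complex.ofRealCLM.analyticAt x)

theorem coeffMatrix_eq_zero_of_polynomial {f : I → I → ℂ} {n : ℕ} {a b : ℂ[X]}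
    (ha : a.natDegree ≤ n) (hb : b.natDegree ≤ n)
    (hf : ∀ t s : I, f t s = a.eval ((t : ℝ) : ℂ) * b.eval ((s : ℝ) : ℂ) *
      heaviside ((t : ℝ) - s)) {k l : ℕ} (hkl : 2 * n + 1 < ((k : ℤ) - l).natAbs) :
    coeffMatrix (ofFun f) k l = 0 := by
  have hbm : BddMeas (Function.uncurry f) := bddMeas_of_mem_sepKernels
    ⟨_, _, analyticOnNhd_eval a _, analyticOnNhd_eval b _, hf⟩
  have key : ∀ (p : ℂ[X]) (j : ℕ), p.natDegree ≤ n → ∃ P : ℂ[X], P.natDegree ≤ n + j + 1 ∧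
      ∀ t s : I, ∫ τ : I, heaviside ((t : ℝ) - τ) * (p.eval ((τ : ℝ) : ℂ) * legendreP j τ) *
        heaviside ((τ : ℝ) - s) =
        (P.eval ((t : ℝ) : ℂ) - P.eval ((s : ℝ) : ℂ)) * heaviside ((t : ℝ) - s) := by
    intro p j hp
    obtain ⟨P, hP, hd⟩ := exists_polynomial_antiderivative (p * legC j)
    refine ⟨P, hd.trans ?_, fun t s => ?_⟩
    · have := natDegree_mul_le (p := p) (q := legC j)
      have := natDegree_legC_le j
      omega
    · have := integral_heaviside_mul (F := fun x : ℝ => (p * legC j).eval (x : ℂ))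
        (P := fun x : ℝ => P.eval (x : ℂ)) (analyticOnNhd_eval _ _).continuousOn
        (fun x _ => by rw [← hP]; exact (P.hasDerivAt (x : ℂ)).comp_ofReal) t s
      simpa [eval_mul, eval_legC] using this
  rcases lt_or_ge k l with h | h
  · obtain ⟨P, hPd, hP⟩ := key a k ha
    rw [coeffMatrix_ofFun' hbm, ← integral_eval_mul_legendreP (k := l)
      (q := b * (C (P.eval 1) - P))]
    · refine integral_congr_ae (ae_of_all _ fun s => ?_)
      have h1 := hP 1 s
      have h2 : ∀ τ : I, heaviside (((1 : I) : ℝ) - τ) = 1 := fun τ => by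
        simp [heaviside, τ.2.2]
      simp only [h2, one_mul, mul_one] at h1
      have h3 : ∀ t : I, f t s * legendreP k t = b.eval ((s : ℝ) : ℂ) *
          (a.eval ((t : ℝ) : ℂ) * legendreP k t * heaviside ((t : ℝ) - s)) := fun t => by
        rw [hf]; ring
      simp only [h3, integral_const_mul, h1, eval_mul, eval_sub, eval_C]
      simp
    · have h1 := natDegree_mul_le (p := b) (q := C (P.eval 1) - P)
      have h2 := natDegree_sub_le (C (P.eval 1)) P
      rw [natDegree_C] at h2
      omega
  · obtain ⟨P, hPd, hP⟩ := key b l hb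
    rw [coeffMatrix_ofFun hbm, ← integral_eval_mul_legendreP (k := k)
      (q := a * (P - C (P.eval 0)))]
    · refine integral_congr_ae (ae_of_all _ fun t => ?_)
      have h1 := hP t 0
      have h2 : ∀ τ : I, heaviside ((τ : ℝ) - ((0 : I) : ℝ)) = 1 := fun τ => by
        simp [heaviside, τ.2.1]
      simp only [h2, mul_one] at h1
      have h3 : ∀ s : I, f t s * legendreP l s = a.eval ((t : ℝ) : ℂ) *
          (heaviside ((t : ℝ) - s) * (b.eval ((s : ℝ) : ℂ) * legendreP l s)) := fun s => by
        rw [hf]; ring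
      simp only [h3, integral_const_mul, h1, eval_mul, eval_sub, eval_C]
      simp
    · have h1 := natDegree_mul_le (p := a) (q := P - C (P.eval 0))
      have h2 := natDegree_sub_le P (C (P.eval 0))
      rw [natDegree_C] at h2
      omega

theorem hasGeometricDecay_of_mem_sepKernels {f : I → I → ℂ} (hf : f ∈ sepKernels) :
    HasGeometricDecay (coeffMatrix (ofFun f)) := by
  have hbf := bddMeas_of_mem_sepKernels hf
  obtain ⟨a, b, ha, hb, hf⟩ := hf
  obtain ⟨A, r, hA, hr0, hr1, happ⟩ := exists_polynomial_approx ha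
  obtain ⟨B, r', hB, hr0', hr1', hbpp⟩ := exists_polynomial_approx hb
  obtain ⟨-, Ma, hMa⟩ := ha.bddMeas
  obtain ⟨-, Mb, hMb⟩ := hb.bddMeas
  have hMa0 : 0 ≤ Ma := (norm_nonneg _).trans (hMa 0)
  have hMb0 : 0 ≤ Mb := (norm_nonneg _).trans (hMb 0)
  set R := max r r' with hR
  have hR0 : 0 < R := lt_max_of_lt_left hr0
  have hR1 : R < 1 := max_lt hr1 hr1'
  set E := Ma * B + A * (Mb + B) with hE
  have hE0 : 0 ≤ E := by positivity
  have hapx : ∀ n k l : ℕ, 2 * n + 1 < ((k : ℤ) - l).natAbs →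
      ‖coeffMatrix (ofFun f) k l‖ ≤ E * R ^ n := by
    intro n k l hkl
    obtain ⟨p, hpd, hp⟩ := happ n
    obtain ⟨q, hqd, hq⟩ := hbpp n
    set g : I → I → ℂ := fun t s =>
      p.eval ((t : ℝ) : ℂ) * q.eval ((s : ℝ) : ℂ) * heaviside ((t : ℝ) - s) with hg
    have hbg : BddMeas (Function.uncurry g) := bddMeas_of_mem_sepKernels
      ⟨_, _, analyticOnNhd_eval p _, analyticOnNhd_eval q _, fun _ _ => rfl⟩
    have hbe : BddMeas (Function.uncurry (f - g)) := by
      have := hbf.add ((BddMeas.const (-1)).mul hbg)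
      simp only [neg_one_mul, ← sub_eq_add_neg] at this
      exact this
    have hsplit : ofFun f = ofFun g + ofFun (f - g) := by
      ext1 <;> simp [ofFun]
    rw [hsplit, coeffMatrix_add (d := ofFun g) (e := ofFun (f - g)) hbg hbe, Matrix.add_apply,
      coeffMatrix_eq_zero_of_polynomial hpd hqd (fun _ _ => rfl) hkl, zero_add]
    refine norm_coeffMatrix_ofFun_le hbe (fun t s => ?_) k l
    have h1 : ‖a t - p.eval ((t : ℝ) : ℂ)‖ ≤ A * R ^ n := (hp t t.2).trans (by
      gcongr; exact le_max_left _ _)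
    have h2 : ‖b s - q.eval ((s : ℝ) : ℂ)‖ ≤ B * R ^ n := (hq s s.2).trans (by
      gcongr; exact le_max_right _ _)
    have h3 : ‖q.eval ((s : ℝ) : ℂ)‖ ≤ Mb + B := by
      have : q.eval ((s : ℝ) : ℂ) = b s - (b s - q.eval ((s : ℝ) : ℂ)) := by ring
      rw [this]
      refine norm_sub_le_of_le (hMb s) (h2.trans ?_)
      exact mul_le_of_le_one_right hB.le (pow_le_one₀ hR0.le hR1.le)
    have h4 : (f - g) t s = (a t * (b s - q.eval ((s : ℝ) : ℂ)) +
        (a t - p.eval ((t : ℝ) : ℂ)) * q.eval ((s : ℝ) : ℂ)) * heaviside ((t : ℝ) - s) := by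
      rw [Pi.sub_apply, Pi.sub_apply, hf, hg]; ring
    rw [h4, norm_mul]
    refine (mul_le_of_le_one_right (norm_nonneg _) (norm_heaviside_le _)).trans ?_
    rw [hE]
    calc _ ≤ Ma * (B * R ^ n) + A * R ^ n * (Mb + B) := by
          refine norm_add_le_of_le ?_ ?_
          · rw [norm_mul]; gcongr; exact hMa t
          · rw [norm_mul]; gcongr
      _ = _ := by ring
  have hbound : ∀ k l : ℕ, ‖coeffMatrix (ofFun f) k l‖ ≤ Ma * Mb := by
    refine norm_coeffMatrix_ofFun_le hbf fun t s => ?_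
    rw [hf, norm_mul, norm_mul]
    refine (mul_le_of_le_one_right (by positivity) (norm_heaviside_le _)).trans ?_
    exact mul_le_mul (hMa t) (hMb s) (norm_nonneg _) hMa0
  set ρ := Real.sqrt R with hρ
  have hρ0 : 0 < ρ := Real.sqrt_pos.mpr hR0
  have hρ1 : ρ < 1 := by rw [hρ, Real.sqrt_lt' one_pos]; simpa using hR1
  have hρρ : ρ ^ 2 = R := Real.sq_sqrt hR0.le
  refine ⟨(E + Ma * Mb + 1) * (ρ ^ 3)⁻¹, ρ, by positivity, hρ0, hρ1, fun k l => ?_⟩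
  set m := ((k : ℤ) - l).natAbs with hm
  rw [mul_assoc, ← div_eq_inv_mul, mul_div_assoc', le_div_iff₀ (by positivity)]
  have hMM : 0 ≤ Ma * Mb := by positivity
  rcases le_or_gt m 1 with h | h
  · calc ‖coeffMatrix (ofFun f) k l‖ * ρ ^ 3 ≤ (Ma * Mb) * ρ ^ m := by
          have := pow_le_pow_of_le_one hρ0.le hρ1.le (h.trans (by norm_num : 1 ≤ 3))
          have := hbound k l
          gcongr
      _ ≤ _ := by gcongr; linarith
  · have h1 := hapx ((m - 2) / 2) k l (by omega)
    have h2 : ρ ^ (2 * ((m - 2) / 2) + 3) ≤ ρ ^ m :=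
      pow_le_pow_of_le_one hρ0.le hρ1.le (by omega)
    calc ‖coeffMatrix (ofFun f) k l‖ * ρ ^ 3 ≤ E * R ^ ((m - 2) / 2) * ρ ^ 3 := by gcongr
      _ = E * ρ ^ (2 * ((m - 2) / 2) + 3) := by rw [← hρρ, ← pow_mul, pow_add]; ring
      _ ≤ E * ρ ^ m := by gcongr
      _ ≤ _ := by gcongr; linarith

theorem hasGeometricDecay_of_mem_span {f : I → I → ℂ} (hf : f ∈ Submodule.span ℂ sepKernels) :
    HasGeometricDecay (coeffMatrix (ofFun f)) := by
  induction hf using Submodule.span_induction with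
  | mem f hf => exact hasGeometricDecay_of_mem_sepKernels hf
  | zero =>
    have : ofFun 0 = (0 : ℂ) • ofFun 0 := by simp [ofFun]
    rw [this, coeffMatrix_smul, zero_smul]
    exact HasGeometricDecay.zero
  | add f g hf hg h1 h2 =>
    have : ofFun (f + g) = ofFun f + ofFun g := by ext1 <;> simp [ofFun]
    rw [this, coeffMatrix_add (d := ofFun f) (e := ofFun g) (bddMeas_of_mem_span hf)
      (bddMeas_of_mem_span hg)]
    exact h1.add h2
  | smul c f _ h =>
    have : ofFun (c • f) = c • ofFun f := by ext1 <;> simp [ofFun]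
    rw [this, coeffMatrix_smul]
    exact h.smul c

/-! ### The coefficient matrix determines the distribution -/

instance isOpenPosMeasure_unitInterval : (volume : Measure I).IsOpenPosMeasure where
  open_pos U hU hne := by
    obtain ⟨V, hV, rfl⟩ := isOpen_induced_iff.mp hU
    obtain ⟨t, ht⟩ := hne
    have hcl : (t : ℝ) ∈ closure (Set.Ioo (0 : ℝ) 1) := by
      rw [closure_Ioo zero_ne_one]; exact t.2
    have hpos : 0 < volume (V ∩ Set.Ioo (0 : ℝ) 1) :=
      (hV.inter isOpen_Ioo).measure_pos volume (mem_closure_iff.mp hcl V hV ht)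
    rw [unitInterval.volume_apply]
    refine (hpos.trans_le (measure_mono ?_)).ne'
    rintro x ⟨hx, hx0, hx1⟩
    exact ⟨⟨x, hx0.le, hx1.le⟩, hx, rfl⟩

theorem legendreP_zero (x : ℝ) : legendreP 0 x = 1 := by
  simp [legendreP, shiftedLegendre]

theorem fst_eq_zero_of_coeffMatrix_eq_zero {d : Dist0} (hb : d ∈ bddDist) (hA : d.2 ∈ ATheta)
    (h0 : distApply d (fun s => (legendreP 0 s : ℂ)) =ᵐ[volume] 0) : d.1 = 0 := by
  obtain ⟨-, K, hK⟩ := id hb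
  obtain ⟨f', -, hf⟩ := hA
  have hK0 : 0 ≤ K := (norm_nonneg _).trans (hK (0, 0))
  have hle : ∀ᵐ t : I, ‖d.1‖ ≤ K * t := by
    filter_upwards [h0] with t ht
    simp only [distApply, legendreP_zero, Complex.ofReal_one, mul_one, Pi.zero_apply] at ht
    rw [eq_neg_of_add_eq_zero_left ht, norm_neg]
    have hint := integral_heaviside_mul (F := fun _ => 1) (P := fun x => (x : ℂ))
      continuousOn_const (fun x _ => Complex.ofRealCLM.hasDerivAt) t 0
    have h2 : ∀ x : ℝ, heaviside x = ((if 0 ≤ x then 1 else 0 : ℝ) : ℂ) := fun x => by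
      unfold heaviside; split_ifs <;> simp
    have h3 : ∀ τ : I, heaviside ((τ : ℝ) - ((0 : I) : ℝ)) = 1 := fun τ => by
      simp [heaviside, τ.2.1]
    simp only [h3, mul_one] at hint
    simp only [h2, integral_complex_ofReal] at hint
    have hint' : ∫ τ : I, (if 0 ≤ (t : ℝ) - τ then 1 else 0 : ℝ) = t := by
      simpa using congrArg Complex.re hint
    rw [← hint', ← integral_const_mul]
    refine norm_integral_le_of_norm_le ?_ (ae_of_all _ fun s => ?_)
    · refine Integrable.const_mul ?_ K
      have := ((bddMeas_left bddMeas_heaviside_sub t).integrable volume).re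
      refine this.congr (ae_of_all _ fun s => ?_)
      simp [h2]
    · split_ifs with hs
      · simpa using hK (t, s)
      · rw [hf]; simp [heaviside, hs]
  have hd := Measure.dense_of_ae hle
  have hclosed : IsClosed {t : I | ‖d.1‖ ≤ K * t} :=
    isClosed_le continuous_const (by fun_prop)
  have : (0 : I) ∈ {t : I | ‖d.1‖ ≤ K * t} := by
    rw [← hclosed.closure_eq]; exact hd 0
  simpa using this

theorem eq_zero_of_mem_ATheta {f : I → I → ℂ} (hf : f ∈ ATheta)
    (h0 : ∀ᵐ t : I, ∀ᵐ s : I, f t s = 0) : f = 0 := by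
  obtain ⟨f', hf', hff⟩ := hf
  have hcont : Continuous fun x : I × I => f' x.1 x.2 :=
    hf'.continuousOn.comp_continuous (f := fun x : I × I => ((x.1 : ℝ), (x.2 : ℝ)))
      (by fun_prop) fun x => ⟨x.1.2, x.2.2⟩
  have hlt : ∀ t s : I, s < t → f' t s = 0 := by
    intro t s hst
    by_contra hne
    have hopen : IsOpen {x : I × I | x.2 < x.1 ∧ f' x.1 x.2 ≠ 0} :=
      (isOpen_lt continuous_snd continuous_fst).inter (isOpen_ne_fun hcont continuous_const)
    obtain ⟨U, V, hU, hV, ht, hs, hUV⟩ := isOpen_prod_iff.mp hopen t s ⟨hst, hne⟩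
    obtain ⟨t', ht', hmem⟩ := (Measure.dense_of_ae h0).inter_open_nonempty U hU ⟨t, ht⟩
    obtain ⟨s', hs', hmem'⟩ := (Measure.dense_of_ae hmem).inter_open_nonempty V hV ⟨s, hs⟩
    obtain ⟨h1, h2⟩ := hUV (Set.mk_mem_prod ht' hs')
    have h3 : f t' s' = 0 := hmem'
    rw [hff] at h3
    have h4 : (s' : ℝ) ≤ t' := h1.le
    simp [heaviside, h4] at h3
    exact h2 h3
  ext t s
  rw [hff, Pi.zero_apply, Pi.zero_apply]
  by_cases hst : (s : ℝ) ≤ t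
  · suffices f' t s = 0 by rw [this, zero_mul]
    let γ : I → I × I := fun δ =>
      (unitInterval.symm (unitInterval.symm δ * unitInterval.symm t), unitInterval.symm δ * s)
    have hγ : Continuous γ := by fun_prop
    have hγ0 : γ 0 = (t, s) := by simp [γ]
    have hz : ∀ δ : I, 0 < δ → f' (γ δ).1 (γ δ).2 = 0 := by
      intro δ hδ
      refine hlt _ _ ?_
      change ((unitInterval.symm δ * s : I) : ℝ) <
        (unitInterval.symm (unitInterval.symm δ * unitInterval.symm t) : I)
      have : (0 : ℝ) < δ := hδ
      have h1 := δ.2.2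
      simp only [unitInterval.coe_symm_eq, Set.Icc.coe_mul]
      nlinarith
    have hclosed : IsClosed {δ : I | f' (γ δ).1 (γ δ).2 = 0} :=
      isClosed_eq (hcont.comp hγ) continuous_const
    have h0mem : (0 : I) ∈ closure (Set.Ioi (0 : I)) := by
      rw [closure_Ioi' ⟨1, by simp⟩]; simp
    have := hclosed.closure_subset_iff.mpr (fun δ hδ => hz δ hδ) h0mem
    simpa [hγ0] using this
  · simp [heaviside, hst]

theorem eq_zero_of_coeffMatrix_eq_zero {d : Dist0} (hb : d ∈ bddDist) (hA : d.2 ∈ ATheta)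
    (h : coeffMatrix d = 0) : d = 0 := by
  have hv : ∀ l, distApply d (fun s => (legendreP l s : ℂ)) =ᵐ[volume] 0 := fun l =>
    ae_eq_zero_of_forall_integral_legendreP
      (((bddMeas_legendreP l).distApply hb).memLp volume 2)
      fun k => by rw [← coeffMatrix_eq hb, h]; rfl
  have h1 := fst_eq_zero_of_coeffMatrix_eq_zero hb hA (hv 0)
  have h2 : d.2 = 0 := eq_zero_of_mem_ATheta hA <| by
    filter_upwards [ae_all_iff.mpr hv] with t ht
    refine ae_eq_zero_of_forall_integral_legendreP ((bddMeas_left hb t).memLp volume 2) fun l => ?_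
    have := ht l
    simp only [distApply, h1, zero_mul, zero_add, Pi.zero_apply] at this
    simpa [mul_comm] using this
  exact Prod.ext h1 h2

end

section

/-! ### The structure of `D0t` -/

theorem AThetaT_subset_sepKernels : AThetaT ⊆ sepKernels := by
  rintro f ⟨a, ha, hf⟩
  exact ⟨a, fun _ => 1, ha, fun _ _ => analyticAt_const, fun t s => by rw [hf, mul_one]⟩

theorem smul_mem_AThetaT {f : I → I → ℂ} (hf : f ∈ AThetaT) (c : ℂ) : c • f ∈ AThetaT := by
  obtain ⟨a, ha, hf⟩ := hf
  exact ⟨fun t => c * a t, fun x hx => analyticAt_const.mul (ha x hx),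
    fun t s => by rw [Pi.smul_apply, Pi.smul_apply, hf, smul_eq_mul, mul_assoc]⟩

theorem starMul_ofFun (f g : I → I → ℂ) :
    starMul (ofFun f) (ofFun g) = ofFun (starFun f g) := by
  ext1 <;> simp [starMul, ofFun]

theorem ofFun_smul (c : ℂ) (f : I → I → ℂ) : ofFun (c • f) = c • ofFun f := by
  ext1 <;> simp [ofFun]

theorem IsStarMonomial.exists_eq_ofFun {d : Dist0} (hd : IsStarMonomial d) :
    ∃ f ∈ Submodule.span ℂ sepKernels, d = ofFun f := by
  induction hd with
  | of g hg => exact ⟨g, Submodule.subset_span (AThetaT_subset_sepKernels hg), rfl⟩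
  | mul g hg d _ ih =>
    obtain ⟨f, hf, rfl⟩ := ih
    exact ⟨_, starFun_mem_span (Submodule.subset_span (AThetaT_subset_sepKernels hg)) hf,
      starMul_ofFun g f⟩

theorem IsStarMonomial.mem_bddDist {d : Dist0} (hd : IsStarMonomial d) : d ∈ bddDist := by
  obtain ⟨f, hf, rfl⟩ := hd.exists_eq_ofFun
  exact bddMeas_of_mem_span hf

theorem IsStarMonomial.smul {d : Dist0} (hd : IsStarMonomial d) (c : ℂ) :
    IsStarMonomial (c • d) := by
  cases hd with
  | of g hg => rw [← ofFun_smul]; exact .of _ (smul_mem_AThetaT hg c)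
  | mul g hg d hd =>
    rw [← isUnitalAlgebraOn_bddDist.smul_mul c _ (IsStarMonomial.of g hg).mem_bddDist _
      hd.mem_bddDist, ← ofFun_smul]
    exact .mul _ (smul_mem_AThetaT hg c) d hd

theorem IsStarMonomial.starMul {d e : Dist0} (hd : IsStarMonomial d) (he : IsStarMonomial e) :
    IsStarMonomial (starMul d e) := by
  induction hd with
  | of g hg => exact .mul g hg e he
  | mul g hg d hd ih =>
    rw [isUnitalAlgebraOn_bddDist.mul_assoc _ (IsStarMonomial.of g hg).mem_bddDist _
      hd.mem_bddDist _ he.mem_bddDist]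
    exact .mul g hg _ ih

/-- The linear span of the products `g₁ ⋆ ⋯ ⋆ g_m`. -/
def monomialSpan : Submodule ℂ Dist0 := Submodule.span ℂ {d | IsStarMonomial d}

theorem mem_monomialSpan_iff {d : Dist0} :
    d ∈ monomialSpan ↔ ∃ (n : ℕ) (g : Fin n → Dist0), (∀ i, IsStarMonomial (g i)) ∧
      d = ∑ i, g i := by
  constructor
  · intro h
    induction h using Submodule.span_induction with
    | mem d hd => exact ⟨1, fun _ => d, fun _ => hd, by simp⟩
    | zero => exact ⟨0, Fin.elim0, fun i => i.elim0, by simp⟩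
    | add d e _ _ hd he =>
      obtain ⟨n, g, hg, rfl⟩ := hd
      obtain ⟨m, h, hh, rfl⟩ := he
      refine ⟨n + m, Fin.append g h, fun i => ?_, by simp [Fin.sum_univ_add]⟩
      induction i using Fin.addCases with
      | left i => simpa using hg i
      | right i => simpa using hh i
    | smul c d _ hd =>
      obtain ⟨n, g, hg, rfl⟩ := hd
      exact ⟨n, fun i => c • g i, fun i => (hg i).smul c, Finset.smul_sum⟩
  · rintro ⟨n, g, hg, rfl⟩
    exact Submodule.sum_mem _ fun i _ => Submodule.subset_span (hg i)

theorem mem_D0t_iff {d : Dist0} :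
    d ∈ D0t ↔ ∃ α : ℂ, ∃ m ∈ monomialSpan, d = α • starOne + m := by
  constructor
  · rintro ⟨α, n, g, hg, rfl⟩
    exact ⟨α, _, mem_monomialSpan_iff.mpr ⟨n, g, hg, rfl⟩, rfl⟩
  · rintro ⟨α, m, hm, rfl⟩
    obtain ⟨n, g, hg, rfl⟩ := mem_monomialSpan_iff.mp hm
    exact ⟨α, n, g, hg, rfl⟩

theorem exists_eq_ofFun_of_mem_monomialSpan {d : Dist0} (hd : d ∈ monomialSpan) :
    ∃ f ∈ Submodule.span ℂ sepKernels, d = ofFun f := by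
  induction hd using Submodule.span_induction with
  | mem d hd => exact hd.exists_eq_ofFun
  | zero => exact ⟨0, Submodule.zero_mem _, rfl⟩
  | add d e _ _ hd he =>
    obtain ⟨f, hf, rfl⟩ := hd
    obtain ⟨g, hg, rfl⟩ := he
    exact ⟨f + g, Submodule.add_mem _ hf hg, by ext1 <;> simp [ofFun]⟩
  | smul c d _ hd =>
    obtain ⟨f, hf, rfl⟩ := hd
    exact ⟨c • f, Submodule.smul_mem _ c hf, (ofFun_smul c f).symm⟩

theorem mem_bddDist_of_mem_monomialSpan {d : Dist0} (hd : d ∈ monomialSpan) : d ∈ bddDist := by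
  obtain ⟨f, hf, rfl⟩ := exists_eq_ofFun_of_mem_monomialSpan hd
  exact bddMeas_of_mem_span hf

theorem exists_eq_add_ofFun_of_mem_D0t {d : Dist0} (hd : d ∈ D0t) :
    ∃ α : ℂ, ∃ f ∈ Submodule.span ℂ sepKernels, d = α • starOne + ofFun f := by
  obtain ⟨α, m, hm, rfl⟩ := mem_D0t_iff.mp hd
  obtain ⟨f, hf, rfl⟩ := exists_eq_ofFun_of_mem_monomialSpan hm
  exact ⟨α, f, hf, rfl⟩

theorem D0t_subset_bddDist : D0t ⊆ bddDist := by
  intro d hd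
  obtain ⟨α, f, hf, rfl⟩ := exists_eq_add_ofFun_of_mem_D0t hd
  exact isUnitalAlgebraOn_bddDist.add_mem _
    (isUnitalAlgebraOn_bddDist.smul_mem α _ isUnitalAlgebraOn_bddDist.one_mem) _
    (bddMeas_of_mem_span hf)

theorem snd_mem_ATheta_of_mem_D0t {d : Dist0} (hd : d ∈ D0t) : d.2 ∈ ATheta := by
  obtain ⟨α, f, hf, rfl⟩ := exists_eq_add_ofFun_of_mem_D0t hd
  simpa [starOne, ofFun] using mem_ATheta_of_mem_span hf

theorem starMul_mem_monomialSpan {d e : Dist0} (hd : d ∈ monomialSpan) (he : e ∈ monomialSpan) :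
    starMul d e ∈ monomialSpan := by
  have hB := isUnitalAlgebraOn_bddDist
  have hb := fun {d : Dist0} (h : d ∈ monomialSpan) => mem_bddDist_of_mem_monomialSpan h
  unfold monomialSpan at hd he
  induction hd, he using Submodule.span_induction₂ with
  | mem_mem d e hd he => exact Submodule.subset_span (hd.starMul he)
  | zero_left e he =>
    have : starMul 0 e = 0 := by ext1 <;> simp [starMul, zero_starFun]
    rw [this]; exact Submodule.zero_mem _
  | zero_right d hd =>
    have : starMul d 0 = 0 := by ext1 <;> simp [starMul, starFun_zero]
    rw [this]; exact Submodule.zero_mem _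
  | add_left d e c hd he hc h1 h2 =>
    rw [hB.add_mul d (hb hd) e (hb he) c (hb hc)]
    exact Submodule.add_mem _ h1
      h2
  | add_right d e c hd he hc h1 h2 =>
    rw [hB.mul_add d (hb hd) e (hb he) c (hb hc)]
    exact Submodule.add_mem _ h1
      h2
  | smul_left r d e hd he h =>
    rw [hB.smul_mul r d (hb hd) e (hb he)]
    exact Submodule.smul_mem _ _ h
  | smul_right r d e hd he h =>
    rw [hB.mul_smul r d (hb hd) e (hb he)]
    exact Submodule.smul_mem _ _ h

theorem starMul_mem_D0t {d e : Dist0} (hd : d ∈ D0t) (he : e ∈ D0t) : starMul d e ∈ D0t := by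
  obtain ⟨α, m, hm, rfl⟩ := mem_D0t_iff.mp hd
  obtain ⟨β, m', hm', rfl⟩ := mem_D0t_iff.mp he
  have h : starMul (α • starOne + m) (β • starOne + m') =
      (α * β) • starOne + (α • m' + β • m + starMul m m') := by
    obtain ⟨f, hf, rfl⟩ := exists_eq_ofFun_of_mem_monomialSpan hm
    obtain ⟨g, hg, rfl⟩ := exists_eq_ofFun_of_mem_monomialSpan hm'
    ext1 <;> simp [starMul, ofFun, starOne]
  rw [h]
  exact mem_D0t_iff.mpr ⟨_, _, Submodule.add_mem _ (Submodule.add_mem _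
    (Submodule.smul_mem _ _ hm') (Submodule.smul_mem _ _ hm)) (starMul_mem_monomialSpan hm hm'),
    rfl⟩

theorem isUnitalAlgebraOn_D0t : IsUnitalAlgebraOn D0t starMul starOne := by
  have hB := isUnitalAlgebraOn_bddDist
  have hs := D0t_subset_bddDist
  have smul_mem : ∀ (c : ℂ), ∀ d ∈ D0t, c • d ∈ D0t := fun c d hd => by
    obtain ⟨α, m, hm, rfl⟩ := mem_D0t_iff.mp hd
    exact mem_D0t_iff.mpr ⟨c * α, c • m, Submodule.smul_mem _ c hm, by rw [smul_add, smul_smul]⟩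
  have one_mem : starOne ∈ D0t :=
    mem_D0t_iff.mpr ⟨1, 0, Submodule.zero_mem _, by simp⟩
  exact
    { zero_mem := by simpa using smul_mem 0 _ one_mem
      one_mem := one_mem
      add_mem := fun d hd e he => by
        obtain ⟨α, m, hm, rfl⟩ := mem_D0t_iff.mp hd
        obtain ⟨β, m', hm', rfl⟩ := mem_D0t_iff.mp he
        exact mem_D0t_iff.mpr ⟨α + β, m + m', Submodule.add_mem _ hm hm', by module⟩
      neg_mem := fun d hd => by simpa using smul_mem (-1) d hd
      smul_mem := smul_mem
      mul_mem := fun d hd e he => starMul_mem_D0t hd he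
      mul_assoc := fun a ha b hb c hc => hB.mul_assoc a (hs ha) b (hs hb) c (hs hc)
      one_mul := fun a ha => hB.one_mul a (hs ha)
      mul_one := fun a ha => hB.mul_one a (hs ha)
      mul_add := fun a ha b hb c hc => hB.mul_add a (hs ha) b (hs hb) c (hs hc)
      add_mul := fun a ha b hb c hc => hB.add_mul a (hs ha) b (hs hb) c (hs hc)
      smul_mul := fun r a ha b hb => hB.smul_mul r a (hs ha) b (hs hb)
      mul_smul := fun r a ha b hb => hB.mul_smul r a (hs ha) b (hs hb) }

theorem hasGeometricDecay_coeffMatrix {d : Dist0} (hd : d ∈ D0t) :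
    HasGeometricDecay (coeffMatrix d) := by
  obtain ⟨α, f, hf, rfl⟩ := exists_eq_add_ofFun_of_mem_D0t hd
  rw [coeffMatrix_add (isUnitalAlgebraOn_bddDist.smul_mem α _ isUnitalAlgebraOn_bddDist.one_mem)
    (e := ofFun f) (bddMeas_of_mem_span hf), coeffMatrix_smul, coeffMatrix_starOne]
  exact (hasGeometricDecay_one.smul α).add (hasGeometricDecay_of_mem_span hf)

theorem isAlgebraIsoOn_coeffMatrix :
    IsAlgebraIsoOn D0t starMul starOne coeffMatrices infMul 1 coeffMatrix where
  bijOn := by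
    refine ⟨fun d hd => ⟨d, hd, rfl⟩, fun d hd e he h => ?_, fun F hF => hF⟩
    have hA := isUnitalAlgebraOn_D0t
    have hne := hA.smul_mem (-1) e he
    have hmem := hA.add_mem d hd _ hne
    have h0 : d + (-1 : ℂ) • e = 0 :=
      eq_zero_of_coeffMatrix_eq_zero (D0t_subset_bddDist hmem) (snd_mem_ATheta_of_mem_D0t hmem) (by
        rw [coeffMatrix_add (D0t_subset_bddDist hd) (D0t_subset_bddDist hne), coeffMatrix_smul]
        rw [show coeffMatrix d = coeffMatrix e from h]; module)
    rw [neg_one_smul, ← sub_eq_add_neg] at h0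
    exact sub_eq_zero.mp h0
  map_add d hd e he := coeffMatrix_add (D0t_subset_bddDist hd) (D0t_subset_bddDist he)
  map_smul c d _ := coeffMatrix_smul c d
  map_mul d hd e he := coeffMatrix_starMul (D0t_subset_bddDist hd) (D0t_subset_bddDist he)
  map_one := coeffMatrix_starOne

/-! ### Transport of algebra structures -/

section Transport

variable {A B : Type*} [AddCommGroup A] [Module ℂ A] [AddCommGroup B] [Module ℂ B]
  {S : Set A} {mulA : A → A → A} {oneA : A} {T : Set B} {mulB : B → B → B} {oneB : B} {φ : A → B}

theorem IsAlgebraIsoOn.isUnitalAlgebraOn (h : IsAlgebraIsoOn S mulA oneA T mulB oneB φ)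
    (hS : IsUnitalAlgebraOn S mulA oneA) : IsUnitalAlgebraOn T mulB oneB := by
  have hφ : ∀ a ∈ S, φ a ∈ T := h.bijOn.mapsTo
  have hsurj : ∀ b ∈ T, ∃ a ∈ S, φ a = b := h.bijOn.surjOn
  have hsm : ∀ (c : ℂ), ∀ b ∈ T, c • b ∈ T := by
    intro c b hb
    obtain ⟨a, ha, rfl⟩ := hsurj b hb
    rw [← h.map_smul c a ha]
    exact hφ _ (hS.smul_mem c a ha)
  have hone : oneB ∈ T := h.map_one ▸ hφ _ hS.one_mem
  refine ⟨by simpa using hsm 0 _ hone, hone, ?_, fun b hb => by simpa using hsm (-1) b hb, hsm,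
    ?_, ?_, ?_, ?_, ?_, ?_, ?_, ?_⟩
  · intro b₀ hb₀ c₀ hc₀
    obtain ⟨b, hb, rfl⟩ := hsurj b₀ hb₀
    obtain ⟨c, hc, rfl⟩ := hsurj c₀ hc₀
    rw [← h.map_add b hb c hc]
    exact hφ _ (hS.add_mem b hb c hc)
  · intro b₀ hb₀ c₀ hc₀
    obtain ⟨b, hb, rfl⟩ := hsurj b₀ hb₀
    obtain ⟨c, hc, rfl⟩ := hsurj c₀ hc₀
    rw [← h.map_mul b hb c hc]
    exact hφ _ (hS.mul_mem b hb c hc)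
  · intro a₀ ha₀ b₀ hb₀ c₀ hc₀
    obtain ⟨a, ha, rfl⟩ := hsurj a₀ ha₀
    obtain ⟨b, hb, rfl⟩ := hsurj b₀ hb₀
    obtain ⟨c, hc, rfl⟩ := hsurj c₀ hc₀
    rw [← h.map_mul a ha b hb, ← h.map_mul _ (hS.mul_mem a ha b hb) c hc, ← h.map_mul b hb c hc,
      ← h.map_mul a ha _ (hS.mul_mem b hb c hc), hS.mul_assoc a ha b hb c hc]
  · intro a₀ ha₀
    obtain ⟨a, ha, rfl⟩ := hsurj a₀ ha₀
    rw [← h.map_one, ← h.map_mul _ hS.one_mem a ha, hS.one_mul a ha]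
  · intro a₀ ha₀
    obtain ⟨a, ha, rfl⟩ := hsurj a₀ ha₀
    rw [← h.map_one, ← h.map_mul a ha _ hS.one_mem, hS.mul_one a ha]
  · intro a₀ ha₀ b₀ hb₀ c₀ hc₀
    obtain ⟨a, ha, rfl⟩ := hsurj a₀ ha₀
    obtain ⟨b, hb, rfl⟩ := hsurj b₀ hb₀
    obtain ⟨c, hc, rfl⟩ := hsurj c₀ hc₀
    rw [← h.map_add b hb c hc, ← h.map_mul a ha _ (hS.add_mem b hb c hc),
      hS.mul_add a ha b hb c hc, h.map_add _ (hS.mul_mem a ha b hb) _ (hS.mul_mem a ha c hc),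
      h.map_mul a ha b hb, h.map_mul a ha c hc]
  · intro a₀ ha₀ b₀ hb₀ c₀ hc₀
    obtain ⟨a, ha, rfl⟩ := hsurj a₀ ha₀
    obtain ⟨b, hb, rfl⟩ := hsurj b₀ hb₀
    obtain ⟨c, hc, rfl⟩ := hsurj c₀ hc₀
    rw [← h.map_add a ha b hb, ← h.map_mul _ (hS.add_mem a ha b hb) c hc,
      hS.add_mul a ha b hb c hc, h.map_add _ (hS.mul_mem a ha c hc) _ (hS.mul_mem b hb c hc),
      h.map_mul a ha c hc, h.map_mul b hb c hc]
  · intro r a₀ ha₀ b₀ hb₀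
    obtain ⟨a, ha, rfl⟩ := hsurj a₀ ha₀
    obtain ⟨b, hb, rfl⟩ := hsurj b₀ hb₀
    rw [← h.map_smul r a ha, ← h.map_mul _ (hS.smul_mem r a ha) b hb, hS.smul_mul r a ha b hb,
      h.map_smul r _ (hS.mul_mem a ha b hb), h.map_mul a ha b hb]
  · intro r a₀ ha₀ b₀ hb₀
    obtain ⟨a, ha, rfl⟩ := hsurj a₀ ha₀
    obtain ⟨b, hb, rfl⟩ := hsurj b₀ hb₀
    rw [← h.map_smul r b hb, ← h.map_mul a ha _ (hS.smul_mem r b hb), hS.mul_smul r a ha b hb,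
      h.map_smul r _ (hS.mul_mem a ha b hb), h.map_mul a ha b hb]

namespace IsUnitalAlgebraOn

theorem mul_zero (hS : IsUnitalAlgebraOn S mulA oneA) {a : A} (ha : a ∈ S) : mulA a 0 = 0 := by
  simpa using hS.mul_smul 0 a ha 0 hS.zero_mem

theorem zero_mul (hS : IsUnitalAlgebraOn S mulA oneA) {a : A} (ha : a ∈ S) : mulA 0 a = 0 := by
  simpa using hS.smul_mul 0 0 hS.zero_mem a ha

theorem sum_mem (hS : IsUnitalAlgebraOn S mulA oneA) {ι : Type*} (s : Finset ι) {f : ι → A}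
    (hf : ∀ i, f i ∈ S) :
    ∑ i ∈ s, f i ∈ S := by
  classical
  induction s using Finset.induction_on with
  | empty => simpa using hS.zero_mem
  | insert i s hi ih => rw [Finset.sum_insert hi]; exact hS.add_mem _ (hf i) _ ih

theorem mul_sum (hS : IsUnitalAlgebraOn S mulA oneA) {ι : Type*} (s : Finset ι) {a : A}
    (ha : a ∈ S) {f : ι → A} (hf : ∀ i, f i ∈ S) :
    mulA a (∑ i ∈ s, f i) = ∑ i ∈ s, mulA a (f i) := by
  classical
  induction s using Finset.induction_on with
  | empty => simpa using hS.mul_zero ha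
  | insert i s hi ih =>
    rw [Finset.sum_insert hi, Finset.sum_insert hi, hS.mul_add a ha _ (hf i) _ (hS.sum_mem s hf),
      ih]

theorem sum_mul (hS : IsUnitalAlgebraOn S mulA oneA) {ι : Type*} (s : Finset ι) {a : A}
    (ha : a ∈ S) {f : ι → A} (hf : ∀ i, f i ∈ S) :
    mulA (∑ i ∈ s, f i) a = ∑ i ∈ s, mulA (f i) a := by
  classical
  induction s using Finset.induction_on with
  | empty => simpa using hS.zero_mul ha
  | insert i s hi ih =>
    rw [Finset.sum_insert hi, Finset.sum_insert hi, hS.add_mul _ (hf i) _ (hS.sum_mem s hf) a ha,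
      ih]

theorem matrix (hS : IsUnitalAlgebraOn S mulA oneA) (N : ℕ) :
    IsUnitalAlgebraOn {M : Matrix (Fin N) (Fin N) A | ∀ i j, M i j ∈ S}
      (fun P Q i j => ∑ m, mulA (P i m) (Q m j)) (fun i j => if i = j then oneA else 0) where
  zero_mem _ _ := hS.zero_mem
  one_mem i j := by
    dsimp only
    split_ifs
    · exact hS.one_mem
    · exact hS.zero_mem
  add_mem P hP Q hQ i j := hS.add_mem _ (hP i j) _ (hQ i j)
  neg_mem P hP i j := hS.neg_mem _ (hP i j)
  smul_mem c P hP i j := hS.smul_mem c _ (hP i j)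
  mul_mem P hP Q hQ i j := hS.sum_mem _ fun m => hS.mul_mem _ (hP i m) _ (hQ m j)
  mul_assoc P hP Q hQ R hR := by
    ext i j
    calc ∑ m, mulA (∑ n, mulA (P i n) (Q n m)) (R m j)
        = ∑ m, ∑ n, mulA (mulA (P i n) (Q n m)) (R m j) := Finset.sum_congr rfl fun m _ =>
          hS.sum_mul _ (hR m j) fun n => hS.mul_mem _ (hP i n) _ (hQ n m)
      _ = ∑ n, ∑ m, mulA (P i n) (mulA (Q n m) (R m j)) := by
          rw [Finset.sum_comm]
          exact Finset.sum_congr rfl fun n _ => Finset.sum_congr rfl fun m _ =>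
            hS.mul_assoc _ (hP i n) _ (hQ n m) _ (hR m j)
      _ = ∑ n, mulA (P i n) (∑ m, mulA (Q n m) (R m j)) := Finset.sum_congr rfl fun n _ =>
          (hS.mul_sum _ (hP i n) fun m => hS.mul_mem _ (hQ n m) _ (hR m j)).symm
  one_mul P hP := by
    ext i j
    refine (Finset.sum_eq_single i (fun m _ hm => ?_) (by simp)).trans ?_
    · change mulA (if i = m then oneA else 0) (P m j) = 0
      rw [if_neg hm.symm, hS.zero_mul (hP m j)]
    · change mulA (if i = i then oneA else 0) (P i j) = P i j
      rw [if_pos rfl, hS.one_mul _ (hP i j)]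
  mul_one P hP := by
    ext i j
    refine (Finset.sum_eq_single j (fun m _ hm => ?_) (by simp)).trans ?_
    · change mulA (P i m) (if m = j then oneA else 0) = 0
      rw [if_neg hm, hS.mul_zero (hP i m)]
    · change mulA (P i j) (if j = j then oneA else 0) = P i j
      rw [if_pos rfl, hS.mul_one _ (hP i j)]
  mul_add P hP Q hQ R hR := by
    ext i j
    exact (Finset.sum_congr rfl fun m _ => hS.mul_add _ (hP i m) _ (hQ m j) _ (hR m j)).trans
      Finset.sum_add_distrib
  add_mul P hP Q hQ R hR := by
    ext i j
    exact (Finset.sum_congr rfl fun m _ => hS.add_mul _ (hP i m) _ (hQ i m) _ (hR m j)).trans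
      Finset.sum_add_distrib
  smul_mul r P hP Q hQ := by
    ext i j
    exact (Finset.sum_congr rfl fun m _ => hS.smul_mul r _ (hP i m) _ (hQ m j)).trans
      Finset.smul_sum.symm
  mul_smul r P hP Q hQ := by
    ext i j
    exact (Finset.sum_congr rfl fun m _ => hS.mul_smul r _ (hP i m) _ (hQ m j)).trans
      Finset.smul_sum.symm

end IsUnitalAlgebraOn

theorem IsAlgebraIsoOn.map_sum (h : IsAlgebraIsoOn S mulA oneA T mulB oneB φ)
    (hS : IsUnitalAlgebraOn S mulA oneA) {ι : Type*} (s : Finset ι) {f : ι → A}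
    (hf : ∀ i, f i ∈ S) : φ (∑ i ∈ s, f i) = ∑ i ∈ s, φ (f i) := by
  classical
  induction s using Finset.induction_on with
  | empty => simpa using h.map_smul 0 0 hS.zero_mem
  | insert i s hi ih =>
    rw [Finset.sum_insert hi, Finset.sum_insert hi, h.map_add _ (hf i) _ (hS.sum_mem s hf), ih]

theorem IsAlgebraIsoOn.matrix (h : IsAlgebraIsoOn S mulA oneA T mulB oneB φ)
    (hS : IsUnitalAlgebraOn S mulA oneA) (N : ℕ) :
    IsAlgebraIsoOn {M : Matrix (Fin N) (Fin N) A | ∀ i j, M i j ∈ S}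
      (fun P Q i j => ∑ m, mulA (P i m) (Q m j)) (fun i j => if i = j then oneA else 0)
      {M : Matrix (Fin N) (Fin N) B | ∀ i j, M i j ∈ T}
      (fun P Q i j => ∑ m, mulB (P i m) (Q m j)) (fun i j => if i = j then oneB else 0)
      (fun M i j => φ (M i j)) where
  bijOn := by
    refine ⟨fun P hP i j => h.bijOn.mapsTo (hP i j), fun P hP Q hQ e => ?_, fun M hM => ?_⟩
    · ext i j
      exact h.bijOn.injOn (hP i j) (hQ i j) (congrFun (congrFun e i) j)
    · choose P hP hPM using fun i j => h.bijOn.surjOn (hM i j)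
      exact ⟨P, hP, funext fun i => funext fun j => hPM i j⟩
  map_add P hP Q hQ := by
    ext i j
    exact h.map_add _ (hP i j) _ (hQ i j)
  map_smul c P hP := by
    ext i j
    exact h.map_smul c _ (hP i j)
  map_mul P hP Q hQ := by
    ext i j
    exact (h.map_sum hS _ fun m => hS.mul_mem _ (hP i m) _ (hQ m j)).trans
      (Finset.sum_congr rfl fun m _ => h.map_mul _ (hP i m) _ (hQ m j))
  map_one := by
    ext i j
    dsimp only
    split_ifs
    · exact h.map_one
    · simpa using h.map_smul 0 0 hS.zero_mem

end Transport

end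

end LegendreStar

end

theorem mainTheorem3 :
    -- the product of the coefficient matrices of two functions of `AThetaT`
    (∀ f ∈ LegendreStar.AThetaT, ∀ g ∈ LegendreStar.AThetaT,
      LegendreStar.ofFun (LegendreStar.starFun f g) ∈ LegendreStar.D0t ∧
      LegendreStar.HasGeometricDecay (LegendreStar.coeffMatrix (LegendreStar.ofFun f)) ∧
      LegendreStar.HasGeometricDecay (LegendreStar.coeffMatrix (LegendreStar.ofFun g)) ∧
      LegendreStar.MulDefined (LegendreStar.coeffMatrix (LegendreStar.ofFun f))
        (LegendreStar.coeffMatrix (LegendreStar.ofFun g)) ∧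
      LegendreStar.coeffMatrix (LegendreStar.ofFun (LegendreStar.starFun f g)) =
        LegendreStar.infMul (LegendreStar.coeffMatrix (LegendreStar.ofFun f))
          (LegendreStar.coeffMatrix (LegendreStar.ofFun g)) ∧
      LegendreStar.HasGeometricDecay
        (LegendreStar.infMul (LegendreStar.coeffMatrix (LegendreStar.ofFun f))
          (LegendreStar.coeffMatrix (LegendreStar.ofFun g)))) ∧
    -- the ring `D0t`, the algebra of coefficient matrices, and their correspondence
    (∀ d ∈ LegendreStar.D0t, d.2 ∈ LegendreStar.ATheta) ∧
    LegendreStar.IsUnitalAlgebraOn LegendreStar.D0t LegendreStar.starMul LegendreStar.starOne ∧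
    (∀ F ∈ LegendreStar.coeffMatrices, LegendreStar.HasGeometricDecay F) ∧
    (∀ F ∈ LegendreStar.coeffMatrices, ∀ G ∈ LegendreStar.coeffMatrices,
      LegendreStar.MulDefined F G) ∧
    LegendreStar.IsUnitalAlgebraOn LegendreStar.coeffMatrices LegendreStar.infMul 1 ∧
    LegendreStar.IsAlgebraIsoOn
      LegendreStar.D0t LegendreStar.starMul LegendreStar.starOne
      LegendreStar.coeffMatrices LegendreStar.infMul 1 LegendreStar.coeffMatrix ∧
    -- the extension to `N × N` matrices
    (∀ N : ℕ,
      (∀ A ∈ LegendreStar.matD0t N, ∀ B ∈ LegendreStar.matD0t N,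
        (∀ i m j, LegendreStar.MulDefined (LegendreStar.blockCoeff A i m)
          (LegendreStar.blockCoeff B m j)) ∧
        LegendreStar.blockCoeff (LegendreStar.matStarMul A B) =
          LegendreStar.blockMul (LegendreStar.blockCoeff A) (LegendreStar.blockCoeff B) ∧
        (∀ i j, LegendreStar.HasGeometricDecay
          (LegendreStar.blockMul (LegendreStar.blockCoeff A) (LegendreStar.blockCoeff B) i j))) ∧
      LegendreStar.IsUnitalAlgebraOn (LegendreStar.matD0t N) LegendreStar.matStarMul
        (LegendreStar.matStarOne N) ∧
      LegendreStar.IsUnitalAlgebraOn (LegendreStar.blockCoeffMatrices N) LegendreStar.blockMul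
        (LegendreStar.blockOne N) ∧
      LegendreStar.IsAlgebraIsoOn
        (LegendreStar.matD0t N) LegendreStar.matStarMul (LegendreStar.matStarOne N)
        (LegendreStar.blockCoeffMatrices N) LegendreStar.blockMul (LegendreStar.blockOne N)
        LegendreStar.blockCoeff) := by
  open LegendreStar in
  have hA := isUnitalAlgebraOn_D0t
  have hiso := isAlgebraIsoOn_coeffMatrix
  have hF := hiso.isUnitalAlgebraOn hA
  have hb := D0t_subset_bddDist
  refine ⟨fun f hf g hg => ?_, fun d hd => snd_mem_ATheta_of_mem_D0t hd, hA, ?_, ?_, hF, hiso,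
    fun N => ⟨fun A hA' B hB' => ?_, hA.matrix N, hF.matrix N, hiso.matrix hA N⟩⟩
  · have hmem : ∀ d, IsStarMonomial d → d ∈ D0t := fun d hd =>
      mem_D0t_iff.mpr ⟨0, d, Submodule.subset_span hd, by simp⟩
    have hf' := hmem _ (.of f hf)
    have hg' := hmem _ (.of g hg)
    have hfg := starMul_mem_D0t hf' hg'
    have e := coeffMatrix_starMul (hb hf') (hb hg')
    rw [starMul_ofFun] at e hfg
    exact ⟨hfg, hasGeometricDecay_coeffMatrix hf', hasGeometricDecay_coeffMatrix hg',
      mulDefined_coeffMatrix (hb hf') (hb hg'), e, e ▸ hasGeometricDecay_coeffMatrix hfg⟩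
  · rintro _ ⟨d, hd, rfl⟩
    exact hasGeometricDecay_coeffMatrix hd
  · rintro _ ⟨d, hd, rfl⟩ _ ⟨e, he, rfl⟩
    exact mulDefined_coeffMatrix (hb hd) (hb he)
  · have hm := (hiso.matrix hA N).map_mul A hA' B hB'
    refine ⟨fun i m j => mulDefined_coeffMatrix (hb (hA' i m)) (hb (hB' m j)), hm, fun i j => ?_⟩
    have e : blockMul (blockCoeff A) (blockCoeff B) i j = coeffMatrix (matStarMul A B i j) :=
      (congrFun (congrFun hm i) j).symm
    rw [e]
    exact hasGeometricDecay_coeffMatrix ((hA.matrix N).mul_mem A hA' B hB' i j)
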